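/- Consider the coupled Sasa–Satsuma–mKdV system $$u_t=u_{xxx}-6c_1|u|^2u_x-3c_1u(|u|^2)_x-3c_2v(uv)_x,$$ $$v_t=v_{xxx}-6c_1|u|^2v_x-3c_1v(|u|^2)_x-6c_2v^2v_x,$$ with $c_1,c_2\in\mathbb R$, $u$ complex-valued and $v$ real-valued. Let $\alpha,\rho_1,\rho_2\in\mathbb R$, let $N\ge 0$ and $0\le h\le\lfloor N/2\rfloor$ be integers, let $d_i,\xi_{i,0}\in\mathbb R$ and $p_i,q_i\in\mathbb C$ ($1\le i\le N$), and put $\kappa=2c_1\rho_1^2+c_2\rho_2^2$. Assume - $d_i=d_{N+1-i}$ and $\xi_{i,0}=\xi_{N+1-i,0}$ for $1\le i\le N$; - $p_i=p_{N+1-i}^*=q_i^*=q_{N+1-i}$ for $1\le i\le h$; - $p_i=q_{N+1-i}\in\mathbb R$ and $p_{N+1-i}=q_i\in\mathbb R$ for $h+1\le i\le\lceil N/2\rceil$; - $p_i+q_j\ne0$ for all $i,j$ (under the preceding relations all other denominators below are then nonzero as well); - $G(p_i,q_i)=0$ for $1\le i\le N$, where $$G(p,q)=\frac{c_1\rho_1^2}{(p-\mathrm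 i\alpha)(q+\mathrm i\alpha)}+\frac{c_1\rho_1^2}{(p+\mathrm i\alpha)(q-\mathrm i\alpha)}+\frac{c_2\rho_2^2}{pq}-1 .$$ Let $\xi_i=p_i(x-3\kappa t)+p_i^3t+\xi_{i,0}$, $\eta_i=q_i(x-3\kappa t)+q_i^3t+\xi_{i,0}$, and let $\tau_{k,l}$ be the $N\times N$ determinant $$\tau_{k,l}=\det\left(\delta_{ij}d_ie^{-\xi_i-\eta_j}+\frac1{p_i+q_j}\left(-\frac{p_i-\mathrm i\alpha}{q_j+\mathrm i\alpha}\right)^k\left(-\frac{p_i}{q_j}\right)^l\right)_{1\le i,j\le N}.$$ Put $f=\tau_{0,0}$, $h_1=\tau_{1,0}$, $h_2=\tau_{0,1}$, $\theta=\alpha x-(\alpha^3+3\alpha\kappa)t$ and $$u=\rho_1\frac{h_1}{f}e^{\mathrm i\theta},\qquad v=\rho_2\frac{h_2}{f}.$$ Then, on the set of all $(x,t)\in\mathbb R^2$ with $f(x,t)\ne0$, the function $v$ is real-valued, $u$ and $v$ are smooth, and $(u,v)$ satisfies the system above. If moreover the $p_i$ are pairwise distinct, then $(u,v)$ has dark-dark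 boundary behaviour: for each $t$ one has $f(x,t)\ne0$ for all sufficiently large $|x|$, and $|u(x,t)|\to|\rho_1|$ and $|v(x,t)|\to|\rho_2|$ as $x\to\pm\infty$. -/

import Mathlib

open Filter Topology Complex ComplexConjugate
open scoped ContDiff

/-- `u` (complex valued) and `v` (real valued) are smooth near the point `(x, t)` and satisfy at
`(x, t)` the coupled Sasa-Satsuma-mKdV system
`u_t = u_xxx - 6 c₁ |u|² u_x - 3 c₁ u (|u|²)_x - 3 c₂ v (u v)_x`,
`v_t = v_xxx - 6 c₁ |u|² v_x - 3 c₁ v (|u|²)_x - 6 c₂ v² v_x`.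
Functions are written `u x t`, with the space variable first. -/
def SolvesSSmKdVAt (c₁ c₂ : ℝ) (u : ℝ → ℝ → ℂ) (v : ℝ → ℝ → ℝ) (x t : ℝ) : Prop :=
  ContDiffAt ℝ ∞ (fun z : ℝ × ℝ => u z.1 z.2) (x, t) ∧
  ContDiffAt ℝ ∞ (fun z : ℝ × ℝ => v z.1 z.2) (x, t) ∧
  deriv (fun s => u x s) t =
      iteratedDeriv 3 (fun y => u y t) x
        - 6 * (c₁ : ℂ) * ((‖u x t‖ ^ 2 : ℝ) : ℂ) * deriv (fun y => u y t) x
        - 3 * (c₁ : ℂ) * u x t * ((deriv (fun y => ‖u y t‖ ^ 2) x : ℝ) : ℂ)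
        - 3 * (c₂ : ℂ) * ((v x t : ℝ) : ℂ) * deriv (fun y => u y t * ((v y t : ℝ) : ℂ)) x ∧
  deriv (fun s => v x s) t =
      iteratedDeriv 3 (fun y => v y t) x
        - 6 * c₁ * ‖u x t‖ ^ 2 * deriv (fun y => v y t) x
        - 3 * c₁ * v x t * deriv (fun y => ‖u y t‖ ^ 2) x
        - 6 * c₂ * v x t ^ 2 * deriv (fun y => v y t) x

/-- The free parameters of the `N`-dark-dark soliton formulas. -/
structure DarkData (N : ℕ) where
  c₁ : ℝ
  c₂ : ℝ
  α : ℝ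
  ρ₁ : ℝ
  ρ₂ : ℝ
  d : Fin N → ℝ
  ξ₀ : Fin N → ℝ
  p : Fin N → ℂ
  q : Fin N → ℂ

namespace DarkData

variable {N : ℕ} (D : DarkData N)

/-- `κ = 2 c₁ ρ₁² + c₂ ρ₂²`. -/
def κ : ℝ := 2 * D.c₁ * D.ρ₁ ^ 2 + D.c₂ * D.ρ₂ ^ 2

/-- `ξ_i = p_i (x - 3 κ t) + p_i³ t + ξ_{i,0}`. -/
noncomputable def ξ (i : Fin N) (x t : ℝ) : ℂ :=
  D.p i * ((x : ℂ) - 3 * (D.κ : ℂ) * (t : ℂ)) + D.p i ^ 3 * (t : ℂ) + (D.ξ₀ i : ℂ)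

/-- `η_i = q_i (x - 3 κ t) + q_i³ t + ξ_{i,0}`. -/
noncomputable def η (i : Fin N) (x t : ℝ) : ℂ :=
  D.q i * ((x : ℂ) - 3 * (D.κ : ℂ) * (t : ℂ)) + D.q i ^ 3 * (t : ℂ) + (D.ξ₀ i : ℂ)

/-- The determinant `τ_{k,l}`. -/
noncomputable def τ (k l : ℤ) (x t : ℝ) : ℂ :=
  (Matrix.of fun i j : Fin N =>
    (if i = j then (D.d i : ℂ) * exp (-D.ξ i x t - D.η j x t) else 0)
      + 1 / (D.p i + D.q j)
          * (-((D.p i - I * (D.α : ℂ)) / (D.q j + I * (D.α : ℂ)))) ^ k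
          * (-(D.p i / D.q j)) ^ l).det

noncomputable def f (x t : ℝ) : ℂ := D.τ 0 0 x t

noncomputable def h₁ (x t : ℝ) : ℂ := D.τ 1 0 x t

noncomputable def h₂ (x t : ℝ) : ℂ := D.τ 0 1 x t

/-- The phase `θ = α x - (α³ + 3 α κ) t` of the background plane wave. -/
noncomputable def θ (x t : ℝ) : ℝ := D.α * x - (D.α ^ 3 + 3 * D.α * D.κ) * t

/-- `u = ρ₁ (h₁ / f) e^{iθ}`. -/
noncomputable def u (x t : ℝ) : ℂ :=
  (D.ρ₁ : ℂ) * (D.h₁ x t / D.f x t) * exp (I * (D.θ x t : ℂ))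

/-- The expression `ρ₂ h₂ / f`, a priori complex valued. -/
noncomputable def w (x t : ℝ) : ℂ := (D.ρ₂ : ℂ) * (D.h₂ x t / D.f x t)

/-- The function `G(p, q)` of the dispersion constraint. -/
noncomputable def G (p q : ℂ) : ℂ :=
  ((D.c₁ * D.ρ₁ ^ 2 : ℝ) : ℂ) / ((p - I * (D.α : ℂ)) * (q + I * (D.α : ℂ)))
    + ((D.c₁ * D.ρ₁ ^ 2 : ℝ) : ℂ) / ((p + I * (D.α : ℂ)) * (q - I * (D.α : ℂ)))
    + ((D.c₂ * D.ρ₂ ^ 2 : ℝ) : ℂ) / (p * q) - 1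

/-- The index-reversal and complex-conjugation relations with `h` conjugate pairs. The index
`i : Fin N` stands for the index `i + 1` of `1, …, N`, so that `i.rev` stands for `N + 1 - (i + 1)`
and `(N + 1) / 2` is `⌈N / 2⌉`. -/
def ConjRel (h : ℕ) : Prop :=
  (∀ i, D.d i = D.d i.rev ∧ D.ξ₀ i = D.ξ₀ i.rev) ∧
  (∀ i : Fin N, (i : ℕ) < h →
    D.p i = conj (D.p i.rev) ∧ conj (D.p i.rev) = conj (D.q i) ∧ conj (D.q i) = D.q i.rev) ∧
  (∀ i : Fin N, h ≤ (i : ℕ) → (i : ℕ) < (N + 1) / 2 →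
    D.p i = D.q i.rev ∧ (D.p i).im = 0 ∧ D.p i.rev = D.q i ∧ (D.p i.rev).im = 0)

end DarkData

/-! Write `M` for the matrix of `τ_{0,0}`, a diagonal matrix of exponentials plus the Cauchy matrix
`1 / (p i + q j)`, and `⟨a, b⟩ = aᵀ M⁻¹ b`. Everything rests on a Sylvester identity: multiplying
the Cauchy entries by `p i + q j`, or by `p i ^ 3 + q j ^ 3`, leaves a kernel of finite rank. So the
`x`- and `t`-derivatives of brackets are polynomials in brackets
(`hasDerivAt_invPairing_cauchyDiag`), and differential identities become algebra.

Shifting `k` or `l` by one is a rank-one perturbation of `M`, so `h₁ / f` and `h₂ / f` equal `1 - ⟨1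
/ (q + a), 1⟩` with `a = iα` and `a = 0`. Times the plane wave with exponent `a`, this gives a
function `ψ` with `ψ_t = ψ_xxx + 3 U ψ_x + (3/2) U_x ψ - 3 κ ψ_x`, where `U = ⟨1, 1⟩_x = (log
f)_xx`. The coefficient of `U_x` requires `⟨q^s, p^r⟩ = ⟨q^r, p^s⟩`, which follows from the reversal
symmetry `q i = p i.rev`.

The constraint `G = 0` closes the system. It writes `p i + q i` as a weighted sum of the numbers `1
/ (p i - a) + 1 / (q i + a)`, `a = ± iα, 0`. A trace formula turns this into a relation between `⟨1,
1⟩` and the brackets `⟨1 / (q + a), 1 / (p - a)⟩`; differentiating it, with the reversal and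
conjugation symmetries, gives `U = κ - 2 c₁ |u|² - c₂ v²` (`potential_eq`). Substitution in the
linear equation yields both nonlinear ones.

At infinity each diagonal entry tends to `0` or `∞`. After rescaling, numerator and denominator tend
to Cauchy-type minors differing by a product of factors that pair off, through conjugation, to
modulus one (`tendsto_norm_det_ratio`). -/

section Pairing

/-! ### Brackets of a diagonal-plus-Cauchy matrix and their derivatives. -/

open Matrix

variable {ι : Type*} [DecidableEq ι]

/-- The matrix `diag e + (1 / (p i + q j))`. -/
noncomputable def cauchyDiag (p q e : ι → ℂ) : Matrix ι ι ℂ :=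
  diagonal e + Matrix.of fun i j => 1 / (p i + q j)

theorem cauchyDiag_apply (p q e : ι → ℂ) (i j : ι) :
    cauchyDiag p q e i j = (if i = j then e i else 0) + 1 / (p i + q j) := by
  simp [cauchyDiag, diagonal_apply]

variable [Fintype ι]

open scoped Matrix.Norms.Operator in
/-- The derivative of the inverse of a matrix-valued function, entry by entry. -/
theorem hasDerivAt_matrix_inv_apply {M : ℝ → Matrix ι ι ℂ} {M' : Matrix ι ι ℂ} {x : ℝ}
    (hM : ∀ i j, HasDerivAt (fun y => M y i j) (M' i j) x) (hdet : (M x).det ≠ 0) (i j : ι) :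
    HasDerivAt (fun y => (M y)⁻¹ i j) (-((M x)⁻¹ * M' * (M x)⁻¹) i j) x := by
  have hM1 : HasDerivAt M M' x := hasDerivAt_pi.2 fun i => hasDerivAt_pi.2 (hM i)
  have hu : IsUnit (M x) := (Matrix.isUnit_iff_isUnit_det _).2 (isUnit_iff_ne_zero.2 hdet)
  have h1 := hasFDerivAt_ringInverse (𝕜 := ℝ) hu.unit
  have h2 : HasDerivAt (fun y => Ring.inverse (M y))
      (-((M x)⁻¹ * M' * (M x)⁻¹)) x := by
    convert! HasFDerivAt.comp_hasDerivAt (f := M) x h1 hM1 using 1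
    simp [ContinuousLinearMap.mulLeftRight_apply]
  have h3 := hasDerivAt_pi.1 (hasDerivAt_pi.1 h2 i) j
  simp only [← nonsing_inv_eq_ringInverse] at h3
  exact h3

/-- The bilinear pairing `aᵀ M⁻¹ b`. -/
noncomputable def invPairing (M : Matrix ι ι ℂ) (a b : ι → ℂ) : ℂ := a ⬝ᵥ (M⁻¹ *ᵥ b)

theorem invPairing_add_left (M : Matrix ι ι ℂ) (a a' b : ι → ℂ) :
    invPairing M (a + a') b = invPairing M a b + invPairing M a' b := by
  simp [invPairing, add_dotProduct]

theorem invPairing_smul_left (M : Matrix ι ι ℂ) (c : ℂ) (a b : ι → ℂ) :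
    invPairing M (c • a) b = c * invPairing M a b := by
  simp [invPairing, smul_dotProduct]

theorem invPairing_add_right (M : Matrix ι ι ℂ) (a b b' : ι → ℂ) :
    invPairing M a (b + b') = invPairing M a b + invPairing M a b' := by
  simp [invPairing, mulVec_add, dotProduct_add]

theorem invPairing_smul_right (M : Matrix ι ι ℂ) (c : ℂ) (a b : ι → ℂ) :
    invPairing M a (c • b) = c * invPairing M a b := by
  simp [invPairing, mulVec_smul, dotProduct_smul]

theorem invPairing_eq_sum (M : Matrix ι ι ℂ) (a b : ι → ℂ) :
    invPairing M a b = ∑ i, ∑ j, a i * (M⁻¹ i j * b j) := by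
  simp [invPairing, dotProduct, mulVec, Finset.mul_sum]

theorem hasDerivAt_invPairing {M : ℝ → Matrix ι ι ℂ} {M' : Matrix ι ι ℂ} {x : ℝ}
    (hM : ∀ i j, HasDerivAt (fun y => M y i j) (M' i j) x) (hdet : (M x).det ≠ 0) (a b : ι → ℂ) :
    HasDerivAt (fun y => invPairing (M y) a b)
      (-(a ⬝ᵥ (((M x)⁻¹ * M' * (M x)⁻¹) *ᵥ b))) x := by
  simp only [invPairing_eq_sum]
  have : -(a ⬝ᵥ (((M x)⁻¹ * M' * (M x)⁻¹) *ᵥ b)) =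
      ∑ i, ∑ j, a i * (-((M x)⁻¹ * M' * (M x)⁻¹) i j * b j) := by
    simp [dotProduct, mulVec, Finset.mul_sum]
  rw [this]
  refine HasDerivAt.fun_sum fun i _ => HasDerivAt.fun_sum fun j _ => ?_
  exact ((hasDerivAt_matrix_inv_apply hM hdet i j).mul_const _).const_mul _

variable {p q e : ι → ℂ}

/-- The Sylvester identity: `g i + k j` cancels the Cauchy denominator, so the Cauchy part
contributes exactly the finite-rank term. -/
theorem diagonal_mul_cauchyDiag_add {κ : Type*} [Fintype κ] (hpq : ∀ i j, p i + q j ≠ 0)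
    {g k : ι → ℂ} {u w : κ → ι → ℂ}
    (hgk : ∀ i j, g i + k j = (p i + q j) * ∑ n, u n i * w n j) :
    diagonal (fun i => (g i + k i) * e i) =
      diagonal g * cauchyDiag p q e + cauchyDiag p q e * diagonal k
        - ∑ n, vecMulVec (u n) (w n) := by
  ext i j
  have h1 : (g i + k j) * (1 / (p i + q j)) = ∑ n, u n i * w n j := by
    rw [hgk, mul_comm, ← mul_assoc, one_div_mul_cancel (hpq i j), one_mul]
  simp only [Matrix.sub_apply, Matrix.add_apply, diagonal_mul, mul_diagonal, cauchyDiag_apply,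
    Matrix.sum_apply,
    vecMulVec_apply, ← h1, diagonal_apply]
  split_ifs with hij
  · subst hij; ring
  · ring

theorem dotProduct_inv_mul_diagonal_mul_inv {κ : Type*} [Fintype κ] (hpq : ∀ i j, p i + q j ≠ 0)
    {g k : ι → ℂ} {u w : κ → ι → ℂ}
    (hgk : ∀ i j, g i + k j = (p i + q j) * ∑ n, u n i * w n j)
    (hdet : (cauchyDiag p q e).det ≠ 0) (a b : ι → ℂ) :
    a ⬝ᵥ (((cauchyDiag p q e)⁻¹ * diagonal (fun i => (g i + k i) * e i) *
        (cauchyDiag p q e)⁻¹) *ᵥ b) =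
      invPairing (cauchyDiag p q e) (a * k) b + invPairing (cauchyDiag p q e) a (g * b)
        - ∑ n, invPairing (cauchyDiag p q e) a (u n) * invPairing (cauchyDiag p q e) (w n) b := by
  rw [diagonal_mul_cauchyDiag_add hpq hgk]
  set M := cauchyDiag p q e with hMdef
  have hu : IsUnit M.det := isUnit_iff_ne_zero.2 hdet
  have e1 : M⁻¹ * (diagonal g * M + M * diagonal k - ∑ n, vecMulVec (u n) (w n)) * M⁻¹ =
      M⁻¹ * diagonal g + diagonal k * M⁻¹ - ∑ n, M⁻¹ * vecMulVec (u n) (w n) * M⁻¹ := by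
    rw [mul_sub, sub_mul, mul_add, add_mul, Finset.mul_sum, Finset.sum_mul]
    congr 2
    · rw [← mul_assoc, mul_nonsing_inv_cancel_right _ _ hu]
    · rw [nonsing_inv_mul_cancel_left _ _ hu]
  have e2 : ∀ n, a ⬝ᵥ ((M⁻¹ * vecMulVec (u n) (w n) * M⁻¹) *ᵥ b) =
      invPairing M a (u n) * invPairing M (w n) b := by
    intro n
    rw [← mulVec_mulVec, ← mulVec_mulVec, vecMulVec_mulVec]
    simp [invPairing, mulVec_smul, dotProduct_smul, mul_comm]
  rw [e1, sub_mulVec, add_mulVec, dotProduct_sub, dotProduct_add, sum_mulVec, dotProduct_sum]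
  simp only [e2]
  congr 1
  rw [add_comm]
  congr 1
  · rw [← mulVec_mulVec]
    simp only [invPairing, dotProduct, mulVec_diagonal, Pi.mul_apply, mul_assoc]
  · rw [← mulVec_mulVec]
    rw [invPairing]
    congr 2
    ext i
    simp [mulVec_diagonal]

/-- Only the diagonal of the matrix moves, and the Sylvester identity rewrites its derivative; hence
brackets are closed under differentiation. -/
theorem hasDerivAt_invPairing_cauchyDiag {κ : Type*} [Fintype κ] (hpq : ∀ i j, p i + q j ≠ 0)
    {g k : ι → ℂ} {u w : κ → ι → ℂ}
    (hgk : ∀ i j, g i + k j = (p i + q j) * ∑ n, u n i * w n j)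
    {E : ℝ → ι → ℂ} {x : ℝ}
    (hE : ∀ i, HasDerivAt (fun y => E y i) (-((g i + k i) * E x i)) x)
    (hdet : (cauchyDiag p q (E x)).det ≠ 0) (a b : ι → ℂ) :
    HasDerivAt (fun y => invPairing (cauchyDiag p q (E y)) a b)
      (invPairing (cauchyDiag p q (E x)) (a * k) b + invPairing (cauchyDiag p q (E x)) a (g * b)
        - ∑ n, invPairing (cauchyDiag p q (E x)) a (u n) *
            invPairing (cauchyDiag p q (E x)) (w n) b) x := by
  rw [← dotProduct_inv_mul_diagonal_mul_inv hpq hgk hdet]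
  have := hasDerivAt_invPairing (M := fun y => cauchyDiag p q (E y))
    (M' := -diagonal (fun i => (g i + k i) * E x i)) (x := x) (fun i j => by
      simp only [cauchyDiag_apply]
      by_cases hij : i = j
      · subst hij
        simpa using (hE i).add_const (1 / (p i + q i))
      · simpa [hij] using hasDerivAt_const x _) hdet a b
  simpa only [mul_neg, neg_mul, neg_mulVec, dotProduct_neg, neg_neg] using this

/-- The pairing of vectors `a`, `b` as a trace: the off-diagonal terms are absorbed by `M`. -/
theorem invPairing_eq_sum_sub {g k a b : ι → ℂ} (hpq : ∀ i j, p i + q j ≠ 0)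
    (hgk : ∀ i j, g i + k j = (p i + q j) * (b i * a j))
    (hdet : (cauchyDiag p q e).det ≠ 0) :
    invPairing (cauchyDiag p q e) a b =
      ∑ i, (g i + k i) - ∑ i, (cauchyDiag p q e)⁻¹ i i * ((g i + k i) * e i) := by
  have h1 := diagonal_mul_cauchyDiag_add (κ := Unit) (e := e) (g := g) (k := k)
    (u := fun _ => b) (w := fun _ => a) hpq (by simpa using hgk)
  set M := cauchyDiag p q e with hMdef
  have hu : IsUnit M.det := isUnit_iff_ne_zero.2 hdet
  have h2 : vecMulVec b a = diagonal g * M + M * diagonal k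
      - diagonal (fun i => (g i + k i) * e i) := by
    rw [h1]; simp
  have h3 : invPairing M a b = (M⁻¹ * vecMulVec b a).trace := by
    rw [mul_vecMulVec, trace_vecMulVec, dotProduct_comm]; rfl
  rw [h3, h2, mul_sub, mul_add, trace_sub, trace_add, nonsing_inv_mul_cancel_left _ _ hu,
    trace_mul_comm, mul_assoc, mul_nonsing_inv _ hu, mul_one, trace_diagonal, trace_diagonal,
    Finset.sum_add_distrib]
  congr 1
  simp [trace, mul_diagonal]

/-- The matrix determinant lemma, which converts shifted tau functions into brackets. -/
theorem det_sub_vecMulVec {M : Matrix ι ι ℂ} (hdet : M.det ≠ 0) (a b : ι → ℂ) :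
    (M - vecMulVec b a).det = M.det * (1 - invPairing M a b) := by
  have h := det_add_replicateCol_mul_replicateRow (ι := Unit) (isUnit_iff_ne_zero.2 hdet) (-b) a
  rw [show replicateCol Unit (-b) * replicateRow Unit a = -vecMulVec b a by
    ext i j; simp [vecMulVec_apply, mul_apply], ← sub_eq_add_neg] at h
  rw [h]
  congr 1
  rw [det_unique]
  rw [Matrix.mul_assoc]
  simp [invPairing, mul_apply, dotProduct, mulVec, sub_eq_add_neg]

end Pairing

/-! ### Brackets of the soliton data and the linear problem. -/

namespace DarkData

variable {N : ℕ} (D : DarkData N)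

/-- The diagonal part `d_i e^{-ξ_i-η_i}` of the matrix of `τ_{k,l}`. -/
noncomputable def diagPart (x t : ℝ) (i : Fin N) : ℂ :=
  (D.d i : ℂ) * exp (-D.ξ i x t - D.η i x t)

/-- The matrix of `τ_{0,0}`. -/
noncomputable def mat (x t : ℝ) : Matrix (Fin N) (Fin N) ℂ :=
  cauchyDiag D.p D.q (D.diagPart x t)

theorem f_eq_det (x t : ℝ) : D.f x t = (D.mat x t).det := by
  unfold f τ mat
  congr 1
  ext i j
  rw [cauchyDiag_apply, Matrix.of_apply]
  by_cases hij : i = j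
  · subst hij; simp [diagPart]
  · simp [hij]

/-- The vector `1 / (q_j + a)`. -/
noncomputable def qInv (a : ℂ) (j : Fin N) : ℂ := (D.q j + a)⁻¹

/-- The vector `1 / (p_i - a)`. -/
noncomputable def pInv (a : ℂ) (i : Fin N) : ℂ := (D.p i - a)⁻¹

/-- The bracket `⟨q^s, p^r⟩`. -/
noncomputable def momentPairing (s r : ℕ) (x t : ℝ) : ℂ :=
  invPairing (D.mat x t) (D.q ^ s) (D.p ^ r)

/-- The bracket `⟨1 / (q + a), p^r⟩`. -/
noncomputable def polePairing (a : ℂ) (r : ℕ) (x t : ℝ) : ℂ :=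
  invPairing (D.mat x t) (D.qInv a) (D.p ^ r)

theorem hasDerivAt_diagPart_x (i : Fin N) (x t : ℝ) :
    HasDerivAt (fun y => D.diagPart y t i) (-((D.p i + D.q i) * D.diagPart x t i)) x := by
  unfold diagPart ξ η
  have hid : HasDerivAt (fun y : ℝ => (y : ℂ)) 1 x := ofRealCLM.hasDerivAt
  have h : HasDerivAt (fun y : ℝ => -(D.p i * ((y : ℂ) - 3 * (D.κ : ℂ) * (t : ℂ))
      + D.p i ^ 3 * (t : ℂ) + (D.ξ₀ i : ℂ)) - (D.q i * ((y : ℂ) - 3 * (D.κ : ℂ) * (t : ℂ))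
      + D.q i ^ 3 * (t : ℂ) + (D.ξ₀ i : ℂ))) (-(D.p i * 1) - D.q i * 1) x :=
    (((((hid.sub_const _).const_mul _).add_const _).add_const _).neg).sub
      ((((hid.sub_const _).const_mul _).add_const _).add_const _)
  convert! h.cexp.const_mul (D.d i : ℂ) using 1
  ring

theorem hasDerivAt_diagPart_t (i : Fin N) (x t : ℝ) :
    HasDerivAt (fun s => D.diagPart x s i)
      (-(((D.p i ^ 3 - 3 * D.κ * D.p i) + (D.q i ^ 3 - 3 * D.κ * D.q i)) * D.diagPart x t i))
      t := by
  unfold diagPart ξ η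
  have hid : HasDerivAt (fun y : ℝ => (y : ℂ)) 1 t := ofRealCLM.hasDerivAt
  have h : HasDerivAt (fun s : ℝ => -(D.p i * ((x : ℂ) - 3 * (D.κ : ℂ) * (s : ℂ))
      + D.p i ^ 3 * (s : ℂ) + (D.ξ₀ i : ℂ)) - (D.q i * ((x : ℂ) - 3 * (D.κ : ℂ) * (s : ℂ))
      + D.q i ^ 3 * (s : ℂ) + (D.ξ₀ i : ℂ)))
      (-(D.p i * -(3 * (D.κ : ℂ) * 1) + D.p i ^ 3 * 1)
        - (D.q i * -(3 * (D.κ : ℂ) * 1) + D.q i ^ 3 * 1)) t :=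
    ((((((hid.const_mul _).const_sub _).const_mul _).add (hid.const_mul _)).add_const _).neg).sub
      (((((hid.const_mul _).const_sub _).const_mul _).add (hid.const_mul _)).add_const _)
  convert! h.cexp.const_mul (D.d i : ℂ) using 1
  ring

variable {D}

theorem hasDerivAt_invPairing_x (hpq : ∀ i j, D.p i + D.q j ≠ 0) {x t : ℝ}
    (hf : D.f x t ≠ 0) (a b : Fin N → ℂ) :
    HasDerivAt (fun y => invPairing (D.mat y t) a b)
      (invPairing (D.mat x t) (a * D.q) b + invPairing (D.mat x t) a (D.p * b)
        - invPairing (D.mat x t) a (D.p ^ 0) * invPairing (D.mat x t) (D.q ^ 0) b) x := by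
  have h := hasDerivAt_invPairing_cauchyDiag (κ := Unit) (g := D.p) (k := D.q)
    (u := fun _ => D.p ^ 0) (w := fun _ => D.q ^ 0) hpq (by simp)
    (E := fun y => D.diagPart y t) (x := x) (fun i => D.hasDerivAt_diagPart_x i x t)
    (by rwa [f_eq_det] at hf) a b
  simpa using! h

theorem hasDerivAt_invPairing_t (hpq : ∀ i j, D.p i + D.q j ≠ 0) {x t : ℝ}
    (hf : D.f x t ≠ 0) (a b : Fin N → ℂ) :
    HasDerivAt (fun s => invPairing (D.mat x s) a b)
      (invPairing (D.mat x t) (a * (D.q ^ 3 + (-3 * D.κ : ℂ) • D.q)) b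
        + invPairing (D.mat x t) a ((D.p ^ 3 + (-3 * D.κ : ℂ) • D.p) * b)
        - (invPairing (D.mat x t) a (D.p ^ 2 + (-3 * D.κ : ℂ) • D.p ^ 0)
              * invPairing (D.mat x t) (D.q ^ 0) b
            - invPairing (D.mat x t) a (D.p ^ 1) * invPairing (D.mat x t) (D.q ^ 1) b
            + invPairing (D.mat x t) a (D.p ^ 0) * invPairing (D.mat x t) (D.q ^ 2) b)) t := by
  have h := hasDerivAt_invPairing_cauchyDiag (κ := Fin 3)
    (g := fun i => D.p i ^ 3 - 3 * D.κ * D.p i) (k := fun i => D.q i ^ 3 - 3 * D.κ * D.q i)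
    -- From `(p³ + q³) / (p + q) = p² - p q + q²`; the drift `-3κ (p + q)` is rank one and joins the
    -- first term.
    (u := ![D.p ^ 2 + (-3 * D.κ : ℂ) • D.p ^ 0, (-1 : ℂ) • D.p ^ 1, D.p ^ 0])
    (w := ![D.q ^ 0, D.q ^ 1, D.q ^ 2]) hpq
    (by intro i j; simp [Fin.sum_univ_three]; ring)
    (E := fun s => D.diagPart x s) (x := t) (fun i => D.hasDerivAt_diagPart_t i x t)
    (by rwa [f_eq_det] at hf) a b
  convert! h using 1
  rw [Fin.sum_univ_three]
  simp only [Matrix.cons_val_zero, Matrix.cons_val_one, Matrix.cons_val, invPairing_smul_right]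
  have e1 : (fun i => D.q i ^ 3 - 3 * D.κ * D.q i) = D.q ^ 3 + (-3 * D.κ : ℂ) • D.q := by
    ext i; simp; ring
  have e2 : (fun i => D.p i ^ 3 - 3 * D.κ * D.p i) = D.p ^ 3 + (-3 * D.κ : ℂ) • D.p := by
    ext i; simp; ring
  rw [e1, e2]
  simp only [mat]
  ring

theorem hasDerivAt_momentPairing (hpq : ∀ i j, D.p i + D.q j ≠ 0) {x t : ℝ}
    (hf : D.f x t ≠ 0) (s r : ℕ) :
    HasDerivAt (fun y => D.momentPairing s r y t)
      (D.momentPairing (s + 1) r x t + D.momentPairing s (r + 1) x t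
        - D.momentPairing s 0 x t * D.momentPairing 0 r x t) x := by
  have h := hasDerivAt_invPairing_x hpq hf (D.q ^ s) (D.p ^ r)
  rwa [← pow_succ, ← pow_succ'] at h

/-- Partial fractions: this keeps the family of pole brackets closed under differentiation. -/
theorem qInv_mul_q {a : ℂ} (ha : ∀ j, D.q j + a ≠ 0) :
    D.qInv a * D.q = D.q ^ 0 + (-a) • D.qInv a := by
  ext j
  have := ha j
  simp only [qInv, Pi.mul_apply, Pi.add_apply, Pi.pow_apply, Pi.smul_apply, smul_eq_mul]
  field_simp
  ring

theorem hasDerivAt_polePairing (hpq : ∀ i j, D.p i + D.q j ≠ 0) {a : ℂ}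
    (ha : ∀ j, D.q j + a ≠ 0) {x t : ℝ} (hf : D.f x t ≠ 0) (r : ℕ) :
    HasDerivAt (fun y => D.polePairing a r y t)
      ((1 - D.polePairing a 0 x t) * D.momentPairing 0 r x t - a * D.polePairing a r x t
        + D.polePairing a (r + 1) x t) x := by
  have h := hasDerivAt_invPairing_x hpq hf (D.qInv a) (D.p ^ r)
  rw [← pow_succ', qInv_mul_q ha, invPairing_add_left, invPairing_smul_left] at h
  convert! h using 1
  simp only [polePairing, momentPairing]
  ring

theorem hasDerivAt_polePairing_t (hpq : ∀ i j, D.p i + D.q j ≠ 0) {a : ℂ}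
    (ha : ∀ j, D.q j + a ≠ 0) {x t : ℝ} (hf : D.f x t ≠ 0) :
    HasDerivAt (fun s => D.polePairing a 0 x s)
      ((1 - D.polePairing a 0 x t) * D.momentPairing 2 0 x t
        - (a - D.polePairing a 1 x t) * D.momentPairing 1 0 x t
        + (a ^ 2 - D.polePairing a 2 x t) * D.momentPairing 0 0 x t
        - a ^ 3 * D.polePairing a 0 x t + D.polePairing a 3 x t
        - 3 * D.κ * ((1 - D.polePairing a 0 x t) * D.momentPairing 0 0 x t
          - a * D.polePairing a 0 x t + D.polePairing a 1 x t)) t := by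
  have h := hasDerivAt_invPairing_t hpq hf (D.qInv a) (D.p ^ 0)
  have e1 : D.qInv a * (D.q ^ 3 + (-3 * D.κ : ℂ) • D.q) =
      D.q ^ 2 + (-a) • D.q ^ 1 + (a ^ 2 - 3 * D.κ : ℂ) • D.q ^ 0
        + (-a ^ 3 + 3 * D.κ * a : ℂ) • D.qInv a := by
    ext j
    have := ha j
    simp only [qInv, Pi.mul_apply, Pi.add_apply, Pi.pow_apply, Pi.smul_apply, smul_eq_mul]
    field_simp
    ring
  have e2 : (D.p ^ 3 + (-3 * D.κ : ℂ) • D.p) * D.p ^ 0 = D.p ^ 3 + (-3 * D.κ : ℂ) • D.p ^ 1 := by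
    rw [pow_zero, mul_one, pow_one]
  rw [e1, e2] at h
  simp only [invPairing_add_left, invPairing_smul_left, invPairing_add_right,
    invPairing_smul_right] at h
  convert! h using 1
  simp only [polePairing, momentPairing]
  ring

/-- The quotient `τ₁ / τ₀` in terms of the resolvent. -/
noncomputable def ratio (a : ℂ) (x t : ℝ) : ℂ := 1 - D.polePairing a 0 x t

/-- The background plane wave of the linear problem. -/
noncomputable def planeWave (D : DarkData N) (a : ℂ) (x t : ℝ) : ℂ :=
  exp (a * ((x : ℂ) - 3 * D.κ * t) + a ^ 3 * t)

/-- The potential `∂ₓ² log f`. -/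
noncomputable def potential (D : DarkData N) (x t : ℝ) : ℂ :=
  D.momentPairing 1 0 x t + D.momentPairing 0 1 x t - D.momentPairing 0 0 x t ^ 2

theorem hasDerivAt_planeWave_x (a : ℂ) (x t : ℝ) :
    HasDerivAt (fun y => D.planeWave a y t) (a * D.planeWave a x t) x := by
  have hid : HasDerivAt (fun y : ℝ => (y : ℂ)) 1 x := ofRealCLM.hasDerivAt
  convert! (((hid.sub_const (3 * (D.κ : ℂ) * t)).const_mul a).add_const (a ^ 3 * (t : ℂ))).cexp
    using 1
  unfold planeWave
  ring

theorem hasDerivAt_planeWave_t (a : ℂ) (x t : ℝ) :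
    HasDerivAt (fun s => D.planeWave a x s) ((a ^ 3 - 3 * D.κ * a) * D.planeWave a x t) t := by
  have hid : HasDerivAt (fun y : ℝ => (y : ℂ)) 1 t := ofRealCLM.hasDerivAt
  convert! ((((hid.const_mul (3 * (D.κ : ℂ))).const_sub (x : ℂ)).const_mul a).add
    (hid.const_mul (a ^ 3))).cexp using 1
  unfold planeWave
  simp only [Pi.add_apply]
  ring

/-- First space derivative of `ratio a * planeWave a`, without the plane wave. -/
noncomputable def waveDeriv₁ (D : DarkData N) (a : ℂ) (x t : ℝ) : ℂ :=
  a - D.polePairing a 1 x t - (1 - D.polePairing a 0 x t) * D.momentPairing 0 0 x t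

/-- Second space derivative of `ratio a * planeWave a`, without the plane wave. -/
noncomputable def waveDeriv₂ (D : DarkData N) (a : ℂ) (x t : ℝ) : ℂ :=
  a ^ 2 - (1 - D.polePairing a 0 x t) * D.momentPairing 0 1 x t - D.polePairing a 2 x t
    - D.waveDeriv₁ a x t * D.momentPairing 0 0 x t
    - (1 - D.polePairing a 0 x t) * D.potential x t

/-- The space derivative of the potential. -/
noncomputable def potentialDeriv (D : DarkData N) (x t : ℝ) : ℂ :=
  D.momentPairing 2 0 x t + 2 * D.momentPairing 1 1 x t + D.momentPairing 0 2 x t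
    - D.momentPairing 0 0 x t * (D.momentPairing 1 0 x t + D.momentPairing 0 1 x t)
    - 2 * D.momentPairing 0 0 x t * D.potential x t

theorem hasDerivAt_momentPairing_zero (hpq : ∀ i j, D.p i + D.q j ≠ 0) {x t : ℝ}
    (hf : D.f x t ≠ 0) :
    HasDerivAt (fun y => D.momentPairing 0 0 y t) (D.potential x t) x := by
  convert hasDerivAt_momentPairing hpq hf 0 0 using 1
  unfold potential
  ring

theorem hasDerivAt_potential (hpq : ∀ i j, D.p i + D.q j ≠ 0) {x t : ℝ}
    (hf : D.f x t ≠ 0) :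
    HasDerivAt (fun y => D.potential y t) (D.potentialDeriv x t) x := by
  convert! ((hasDerivAt_momentPairing hpq hf 1 0).add (hasDerivAt_momentPairing hpq hf 0 1)).sub
    ((hasDerivAt_momentPairing_zero hpq hf).pow 2) using 1
  unfold potentialDeriv
  simp
  ring

theorem hasDerivAt_wave (hpq : ∀ i j, D.p i + D.q j ≠ 0) {a : ℂ}
    (ha : ∀ j, D.q j + a ≠ 0) {x t : ℝ} (hf : D.f x t ≠ 0) :
    HasDerivAt (fun y => D.ratio a y t * D.planeWave a y t)
      (D.waveDeriv₁ a x t * D.planeWave a x t) x := by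
  convert! ((hasDerivAt_polePairing hpq ha hf 0).const_sub 1).mul
    (hasDerivAt_planeWave_x a x t) using 1
  unfold waveDeriv₁
  ring

theorem hasDerivAt_waveDeriv₁ (hpq : ∀ i j, D.p i + D.q j ≠ 0) {a : ℂ}
    (ha : ∀ j, D.q j + a ≠ 0) {x t : ℝ} (hf : D.f x t ≠ 0) :
    HasDerivAt (fun y => D.waveDeriv₁ a y t * D.planeWave a y t)
      (D.waveDeriv₂ a x t * D.planeWave a x t) x := by
  convert! (((hasDerivAt_polePairing hpq ha hf 1).const_sub a).sub
    (((hasDerivAt_polePairing hpq ha hf 0).const_sub 1).mul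
      (hasDerivAt_momentPairing_zero hpq hf))).mul (hasDerivAt_planeWave_x a x t) using 1
  unfold waveDeriv₂ waveDeriv₁
  simp only [Pi.sub_apply, Pi.mul_apply]
  ring

theorem hasDerivAt_waveDeriv₂ (hpq : ∀ i j, D.p i + D.q j ≠ 0) {a : ℂ}
    (ha : ∀ j, D.q j + a ≠ 0) {x t : ℝ} (hf : D.f x t ≠ 0) :
    HasDerivAt (fun y => D.waveDeriv₂ a y t * D.planeWave a y t)
      ((a ^ 3 - (1 - D.polePairing a 0 x t) * D.momentPairing 0 2 x t - D.polePairing a 3 x t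
        - D.waveDeriv₁ a x t * D.momentPairing 0 1 x t
        - (1 - D.polePairing a 0 x t) *
          (D.momentPairing 1 1 x t + D.momentPairing 0 2 x t
            - D.momentPairing 0 0 x t * D.momentPairing 0 1 x t)
        - D.waveDeriv₂ a x t * D.momentPairing 0 0 x t
        - 2 * D.waveDeriv₁ a x t * D.potential x t
        - (1 - D.polePairing a 0 x t) * D.potentialDeriv x t) * D.planeWave a x t) x := by
  have h0 := (hasDerivAt_polePairing hpq ha hf 0).const_sub 1
  have h1 := ((hasDerivAt_polePairing hpq ha hf 1).const_sub a).sub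
    (h0.mul (hasDerivAt_momentPairing_zero hpq hf))
  convert! (((((h0.mul (hasDerivAt_momentPairing hpq hf 0 1)).const_sub (a ^ 2)).sub
    (hasDerivAt_polePairing hpq ha hf 2)).sub
    (h1.mul (hasDerivAt_momentPairing_zero hpq hf))).sub
    (h0.mul (hasDerivAt_potential hpq hf))).mul (hasDerivAt_planeWave_x a x t) using 1
  unfold waveDeriv₂ waveDeriv₁
  simp only [Pi.sub_apply, Pi.mul_apply]
  ring

theorem hasDerivAt_wave_t (hpq : ∀ i j, D.p i + D.q j ≠ 0) {a : ℂ}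
    (ha : ∀ j, D.q j + a ≠ 0) {x t : ℝ} (hf : D.f x t ≠ 0)
    (hsymm : ∀ s r, D.momentPairing s r x t = D.momentPairing r s x t) :
    HasDerivAt (fun s => D.ratio a x s * D.planeWave a x s)
      ((a ^ 3 - (1 - D.polePairing a 0 x t) * D.momentPairing 0 2 x t - D.polePairing a 3 x t
        - D.waveDeriv₁ a x t * D.momentPairing 0 1 x t
        - (1 - D.polePairing a 0 x t) *
          (D.momentPairing 1 1 x t + D.momentPairing 0 2 x t
            - D.momentPairing 0 0 x t * D.momentPairing 0 1 x t)
        - D.waveDeriv₂ a x t * D.momentPairing 0 0 x t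
        - 2 * D.waveDeriv₁ a x t * D.potential x t
        - (1 - D.polePairing a 0 x t) * D.potentialDeriv x t) * D.planeWave a x t
      + 3 * D.potential x t * (D.waveDeriv₁ a x t * D.planeWave a x t)
      + 3 / 2 * D.potentialDeriv x t * (D.ratio a x t * D.planeWave a x t)
      - 3 * D.κ * (D.waveDeriv₁ a x t * D.planeWave a x t)) t := by
  convert! ((hasDerivAt_polePairing_t hpq ha hf).const_sub 1).mul
    (hasDerivAt_planeWave_t a x t) using 1
  unfold waveDeriv₂ waveDeriv₁ potentialDeriv potential ratio
  -- Without symmetric brackets the zeroth-order coefficient would not reduce to `(3/2) U_x`.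
  rw [hsymm 2 0, hsymm 1 0]
  ring

end DarkData

/-! ### Reversal and conjugation symmetries. -/

open scoped Matrix in
theorem invPairing_submatrix_transpose {ι : Type*} [Fintype ι] [DecidableEq ι]
    {M : Matrix ι ι ℂ} (σ : Equiv.Perm ι) (h : ∀ i j, M (σ j) (σ i) = M i j) (a b : ι → ℂ) :
    invPairing M (a ∘ σ) (b ∘ σ) = invPairing M b a := by
  have h1 : M = Mᵀ.submatrix σ σ := by
    ext i j; simp [h]
  have h2 : M⁻¹ = (M⁻¹)ᵀ.submatrix σ σ := by
    conv_lhs => rw [h1]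
    rw [Matrix.inv_submatrix_equiv, Matrix.transpose_nonsing_inv]
  have h3 : ∀ i j, M⁻¹ i j = M⁻¹ (σ j) (σ i) := fun i j => congrFun (congrFun h2 i) j
  simp only [invPairing_eq_sum, Function.comp_apply]
  rw [Finset.sum_comm, ← Equiv.sum_comp σ (fun i => ∑ j, b i * (M⁻¹ i j * a j))]
  refine Finset.sum_congr rfl fun i _ => ?_
  rw [← Equiv.sum_comp σ (fun j => b (σ i) * (M⁻¹ (σ i) j * a j))]
  refine Finset.sum_congr rfl fun j _ => ?_
  rw [h3 j i]
  ring

theorem conj_invPairing {ι : Type*} [Fintype ι] [DecidableEq ι]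
    {M : Matrix ι ι ℂ} (σ : Equiv.Perm ι) (h : ∀ i j, M (σ i) (σ j) = conj (M i j))
    {a b a' b' : ι → ℂ} (ha : ∀ i, a' (σ i) = conj (a i)) (hb : ∀ i, b' (σ i) = conj (b i)) :
    conj (invPairing M a b) = invPairing M a' b' := by
  have h1 : M.map conj = M.submatrix σ σ := by
    ext i j; simp [h]
  have h2 : (M⁻¹).map conj = M⁻¹.submatrix σ σ := by
    rw [← Matrix.inv_submatrix_equiv, ← h1]
    have := Matrix.conjTranspose_nonsing_inv M
    have h3 : ∀ A : Matrix ι ι ℂ, A.map conj = (A.conjTranspose).transpose := fun A => by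
      ext i j; simp
    rw [h3, h3, this, Matrix.transpose_nonsing_inv]
  have h4 : ∀ i j, conj (M⁻¹ i j) = M⁻¹ (σ i) (σ j) := fun i j => congrFun (congrFun h2 i) j
  simp only [invPairing_eq_sum, map_sum, map_mul, h4, ← ha, ← hb]
  rw [← Equiv.sum_comp σ (fun i => ∑ j, a' i * (M⁻¹ i j * b' j))]
  exact Finset.sum_congr rfl fun i _ =>
    Equiv.sum_comp σ (fun j => a' (σ i) * (M⁻¹ (σ i) j * b' j))

namespace DarkData

variable {N : ℕ} {D : DarkData N}

namespace ConjRel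

variable {h : ℕ}

/-- The relations are given on half of the indices; applying them at `i.rev` covers the other half.
-/
theorem cases_index (hc : D.ConjRel h) (i : Fin N) :
    (D.q i = D.p i.rev ∧ D.p i = D.q i.rev) ∧
      ((D.q i = conj (D.p i) ∧ D.q i.rev = conj (D.p i.rev) ∧ ((i : ℕ) < h ∨ (i.rev : ℕ) < h)) ∨
      ((D.p i).im = 0 ∧ (D.q i).im = 0 ∧ ¬ ((i : ℕ) < h ∨ (i.rev : ℕ) < h))) := by
  obtain ⟨-, h1, h2⟩ := hc
  have key : ∀ i : Fin N, (i : ℕ) < h →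
      (D.q i = D.p i.rev ∧ D.p i = D.q i.rev) ∧ D.q i = conj (D.p i) ∧
        D.q i.rev = conj (D.p i.rev) := by
    intro i hi
    obtain ⟨e1, e2, e3⟩ := h1 i hi
    have e4 : D.p i.rev = D.q i := star_injective e2
    refine ⟨⟨e4.symm, by rw [← e3, ← e2, ← e1]⟩, ?_, ?_⟩
    · rw [e1, conj_conj, e4]
    · rw [← e3, e4]
  have key2 : ∀ i : Fin N, h ≤ (i : ℕ) → (i : ℕ) < (N + 1) / 2 →
      (D.q i = D.p i.rev ∧ D.p i = D.q i.rev) ∧ (D.p i).im = 0 ∧ (D.q i).im = 0 := by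
    intro i hi hi2
    obtain ⟨e1, e2, e3, e4⟩ := h2 i hi hi2
    exact ⟨⟨e3.symm, e1⟩, e2, e3 ▸ e4⟩
  have hrev : (i.rev : ℕ) = N - (i + 1) := Fin.val_rev i
  have hiN := i.isLt
  by_cases hi : (i : ℕ) < h
  · obtain ⟨e1, e2, e3⟩ := key i hi
    exact ⟨e1, Or.inl ⟨e2, e3, Or.inl hi⟩⟩
  by_cases hi' : (i.rev : ℕ) < h
  · obtain ⟨e1, e2, e3⟩ := key i.rev hi'
    rw [Fin.rev_rev] at e1 e3
    exact ⟨⟨e1.2.symm, e1.1.symm⟩, Or.inl ⟨e3, e2, Or.inr hi'⟩⟩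
  refine (le_or_gt ((N + 1) / 2) (i : ℕ)).elim (fun hge => ?_) (fun hlt => ?_)
  · obtain ⟨e1, e2, e3⟩ := key2 i.rev (by omega) (by omega)
    rw [Fin.rev_rev] at e1
    exact ⟨⟨e1.2.symm, e1.1.symm⟩, Or.inr ⟨by rw [← e1.1]; exact e3, by rw [← e1.2]; exact e2,
      by tauto⟩⟩
  · obtain ⟨e1, e2, e3⟩ := key2 i (by omega) hlt
    exact ⟨e1, Or.inr ⟨e2, e3, by tauto⟩⟩

theorem q_eq (hc : D.ConjRel h) (i : Fin N) : D.q i = D.p i.rev :=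
  (hc.cases_index i).1.1

theorem p_eq (hc : D.ConjRel h) (i : Fin N) : D.p i = D.q i.rev :=
  (hc.cases_index i).1.2

theorem add_im (hc : D.ConjRel h) (i : Fin N) : (D.p i + D.q i).im = 0 := by
  rcases (hc.cases_index i).2 with ⟨e, -⟩ | ⟨e1, e2, -⟩
  · simp [e]
  · simp [e1, e2]

/-- If `p i` were imaginary, then `p i + q i = 2 Re (p i)` would vanish in the conjugate case, and
`p i + q i.rev = 2 p i` in the real case. -/
theorem p_re_ne_zero (hc : D.ConjRel h) (hpq : ∀ i j, D.p i + D.q j ≠ 0)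
    (i : Fin N) : (D.p i).re ≠ 0 := by
  intro h0
  rcases (hc.cases_index i).2 with ⟨e, -⟩ | ⟨e1, -, -⟩
  · exact hpq i i (Complex.ext (by simp [e, h0]) (by simp [e]))
  · have : D.p i = 0 := Complex.ext h0 e1
    apply hpq i i.rev
    rw [← hc.p_eq, this, add_zero]

/-- Complex conjugation of the parameters is a permutation of the indices. -/
theorem exists_perm (hc : D.ConjRel h) :
    ∃ σ : Equiv.Perm (Fin N), ∀ i, D.p (σ i) = conj (D.p i) ∧ D.q (σ i) = conj (D.q i) ∧
      D.d (σ i) = D.d i ∧ D.ξ₀ (σ i) = D.ξ₀ i := by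
  -- Conjugation swaps the members of a conjugate pair and fixes real parameters.
  let s : Fin N → Fin N := fun i => if (i : ℕ) < h ∨ (i.rev : ℕ) < h then i.rev else i
  have hs : Function.Involutive s := by
    intro i
    by_cases hi : (i : ℕ) < h ∨ (i.rev : ℕ) < h
    · have hi' : (i.rev : ℕ) < h ∨ (i.rev.rev : ℕ) < h := by rw [Fin.rev_rev]; tauto
      simp only [s, if_pos hi, if_pos hi', Fin.rev_rev]
    · simp only [s, if_neg hi]
  refine ⟨hs.toPerm, fun i => ?_⟩
  have hd := hc.1 i
  change D.p (s i) = _ ∧ D.q (s i) = _ ∧ D.d (s i) = _ ∧ D.ξ₀ (s i) = _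
  obtain ⟨⟨e1, e2⟩, e3⟩ := hc.cases_index i
  rcases e3 with ⟨e4, e5, hi⟩ | ⟨e4, e5, hi⟩
  · simp only [s, if_pos hi]
    exact ⟨by rw [← e1, e4], by rw [← e2, e4, conj_conj], hd.1.symm, hd.2.symm⟩
  · simp only [s, if_neg hi]
    exact ⟨(conj_eq_iff_im.2 e4).symm, (conj_eq_iff_im.2 e5).symm, trivial, trivial⟩

theorem diagPart_rev (hc : D.ConjRel h) (x t : ℝ) (i : Fin N) :
    D.diagPart x t i.rev = D.diagPart x t i := by
  simp only [diagPart, ξ, η, ← hc.q_eq, ← hc.p_eq, ← (hc.1 i).1, ← (hc.1 i).2]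
  congr 2
  ring

/-- Reversal exchanges `p` with `q` and preserves the exponentials, so it transposes the matrix. -/
theorem invPairing_rev (hc : D.ConjRel h) (x t : ℝ) (a b : Fin N → ℂ) :
    invPairing (D.mat x t) (a ∘ Fin.rev) (b ∘ Fin.rev) = invPairing (D.mat x t) b a := by
  refine invPairing_submatrix_transpose (M := D.mat x t) Fin.revPerm (fun i j => ?_) a b
  simp only [mat, cauchyDiag_apply, Fin.revPerm_apply, Fin.rev_inj, hc.diagPart_rev,
    ← hc.q_eq, ← hc.p_eq, add_comm (D.q j)]
  by_cases hij : i = j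
  · simp [hij]
  · simp [hij, Ne.symm hij]

theorem momentPairing_comm (hc : D.ConjRel h) (x t : ℝ) (s r : ℕ) :
    D.momentPairing s r x t = D.momentPairing r s x t := by
  unfold momentPairing
  rw [← hc.invPairing_rev]
  congr 1
  · ext i; simp [← hc.q_eq]
  · ext i; simp [← hc.p_eq]

theorem invPairing_pInv (hc : D.ConjRel h) (a : ℂ) (x t : ℝ) :
    invPairing (D.mat x t) (D.q ^ 0) (D.pInv a) = D.polePairing (-a) 0 x t := by
  unfold polePairing
  rw [← hc.invPairing_rev]
  congr 1
  ext i; simp [qInv, pInv, ← hc.q_eq, sub_eq_add_neg]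

theorem diagPart_perm {σ : Equiv.Perm (Fin N)} (hσ : ∀ i, D.p (σ i) = conj (D.p i) ∧
    D.q (σ i) = conj (D.q i) ∧ D.d (σ i) = D.d i ∧ D.ξ₀ (σ i) = D.ξ₀ i) (x t : ℝ) (i : Fin N) :
    D.diagPart x t (σ i) = conj (D.diagPart x t i) := by
  obtain ⟨e1, e2, e3, e4⟩ := hσ i
  simp [diagPart, ξ, η, e1, e2, e3, e4, ← exp_conj, Complex.conj_ofNat]

theorem conj_ratio (hc : D.ConjRel h) (a : ℂ) (x t : ℝ) :
    conj (D.ratio a x t) = D.ratio (conj a) x t := by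
  obtain ⟨σ, hσ⟩ := hc.exists_perm
  unfold ratio polePairing
  rw [map_sub, map_one]
  congr 1
  refine conj_invPairing σ (fun i j => ?_) (fun i => ?_) (fun i => by simp)
  · simp only [mat, cauchyDiag_apply, diagPart_perm hσ, EmbeddingLike.apply_eq_iff_eq,
      (hσ _).1, (hσ _).2.1]
    split_ifs <;> simp
  · simp [qInv, (hσ i).2.1]

end ConjRel

/-! ### Tau quotients and the constraint on the potential. -/

/-- With `a = iα`, `-(p - a) / ((p + q)(q + a)) = 1 / (p + q) - 1 / (q + a)`: the shift subtracts a
rank-one matrix. -/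
theorem τ_one_zero (hpq : ∀ i j, D.p i + D.q j ≠ 0) (x t : ℝ)
    (ha : ∀ j, D.q j + I * D.α ≠ 0) (hf : D.f x t ≠ 0) :
    D.h₁ x t = D.f x t * D.ratio (I * D.α) x t := by
  rw [f_eq_det] at *
  unfold ratio polePairing
  rw [← det_sub_vecMulVec hf]
  unfold h₁ τ
  congr 1
  ext i j
  have h1 := hpq i j
  have h2 := ha j
  simp only [Matrix.of_apply, Matrix.sub_apply, mat, cauchyDiag_apply, Matrix.vecMulVec_apply,
    diagPart, qInv, pow_zero, Pi.one_apply, zpow_one, zpow_zero, mul_one]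
  split_ifs with hij
  · subst hij; field_simp; ring
  · field_simp; ring

theorem τ_zero_one (hpq : ∀ i j, D.p i + D.q j ≠ 0) (x t : ℝ)
    (ha : ∀ j, D.q j ≠ 0) (hf : D.f x t ≠ 0) :
    D.h₂ x t = D.f x t * D.ratio 0 x t := by
  rw [f_eq_det] at *
  unfold ratio polePairing
  rw [← det_sub_vecMulVec hf]
  unfold h₂ τ
  congr 1
  ext i j
  have h1 := hpq i j
  have h2 := ha j
  simp only [Matrix.of_apply, Matrix.sub_apply, mat, cauchyDiag_apply, Matrix.vecMulVec_apply,
    diagPart, qInv, pow_zero, Pi.one_apply, zpow_one, zpow_zero, mul_one, add_zero]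
  split_ifs with hij
  · subst hij; field_simp; ring
  · field_simp; ring

theorem contDiff_τ (k l : ℤ) : ContDiff ℝ ∞ (fun z : ℝ × ℝ => D.τ k l z.1 z.2) := by
  unfold τ
  simp only [Matrix.det_apply, Matrix.of_apply]
  have h1 : ContDiff ℝ ∞ (fun z : ℝ × ℝ => (z.1 : ℂ)) := ofRealCLM.contDiff.comp contDiff_fst
  have h2 : ContDiff ℝ ∞ (fun z : ℝ × ℝ => (z.2 : ℂ)) := ofRealCLM.contDiff.comp contDiff_snd
  refine ContDiff.sum fun s _ => ContDiff.const_smul _ (contDiff_prod fun i _ => ?_)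
  refine ContDiff.add ?_ contDiff_const
  unfold ξ η
  split_ifs
  · fun_prop
  · exact contDiff_const

theorem eventually_f_ne_zero {x t : ℝ} (hf : D.f x t ≠ 0) : ∀ᶠ y in 𝓝 x, D.f y t ≠ 0 := by
  have hc : Continuous (fun y : ℝ => D.τ 0 0 y t) :=
    Continuous.comp (g := fun z : ℝ × ℝ => D.τ 0 0 z.1 z.2) (f := fun y => (y, t))
      (contDiff_τ 0 0).continuous (by fun_prop)
  exact hc.continuousAt.eventually_ne hf

theorem eventually_f_ne_zero_t {x t : ℝ} (hf : D.f x t ≠ 0) : ∀ᶠ s in 𝓝 t, D.f x s ≠ 0 := by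
  have hc : Continuous (fun s : ℝ => D.τ 0 0 x s) :=
    Continuous.comp (g := fun z : ℝ × ℝ => D.τ 0 0 z.1 z.2) (f := fun s => (x, s))
      (contDiff_τ 0 0).continuous (by fun_prop)
  exact hc.continuousAt.eventually_ne hf

theorem invPairing_qInv_pInv (hpq : ∀ i j, D.p i + D.q j ≠ 0) {a : ℂ}
    (hp : ∀ i, D.p i - a ≠ 0) (hq : ∀ j, D.q j + a ≠ 0) {x t : ℝ} (hf : D.f x t ≠ 0) :
    invPairing (D.mat x t) (D.qInv a) (D.pInv a) = ∑ i, (D.pInv a i + D.qInv a i)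
      - ∑ i, (D.mat x t)⁻¹ i i * ((D.pInv a i + D.qInv a i) * D.diagPart x t i) := by
  refine invPairing_eq_sum_sub hpq (fun i j => ?_) (by rwa [f_eq_det] at hf)
  have h1 := hp i
  have h2 := hq j
  simp only [pInv, qInv]
  field_simp
  ring

/-- By partial fractions the terms `± a ⟨1 / (q + a), 1 / (p - a)⟩` cancel, and the rest factors. -/
theorem hasDerivAt_invPairing_qInv_pInv (hpq : ∀ i j, D.p i + D.q j ≠ 0) {a : ℂ}
    (hp : ∀ i, D.p i - a ≠ 0) (hq : ∀ j, D.q j + a ≠ 0) {x t : ℝ} (hf : D.f x t ≠ 0) :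
    HasDerivAt (fun y => invPairing (D.mat y t) (D.qInv a) (D.pInv a))
      (1 - D.ratio a x t * (1 - invPairing (D.mat x t) (D.q ^ 0) (D.pInv a))) x := by
  have h := hasDerivAt_invPairing_x hpq hf (D.qInv a) (D.pInv a)
  have e : D.p * D.pInv a = D.p ^ 0 + a • D.pInv a := by
    ext i
    have := hp i
    simp only [pInv, Pi.mul_apply, Pi.add_apply, Pi.pow_apply, Pi.smul_apply, smul_eq_mul]
    field_simp
    ring
  rw [qInv_mul_q hq, e, invPairing_add_left, invPairing_smul_left, invPairing_add_right,
    invPairing_smul_right] at h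
  convert! h using 1
  simp only [ratio, polePairing]
  ring

/-- This is `(G + 1)(p + q) = p + q`, using `(p + q) / ((p - a)(q + a)) = 1 / (p - a) + 1 / (q +
a)`. -/
theorem sum_weights_eq {i : Fin N} (hG : D.G (D.p i) (D.q i) = 0)
    (h1 : D.p i - I * D.α ≠ 0) (h2 : D.q i + I * D.α ≠ 0)
    (h3 : D.p i + I * D.α ≠ 0) (h4 : D.q i - I * D.α ≠ 0) (h5 : D.p i ≠ 0) (h6 : D.q i ≠ 0) :
    ((D.c₁ * D.ρ₁ ^ 2 : ℝ) : ℂ) * (D.pInv (I * D.α) i + D.qInv (I * D.α) i)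
      + ((D.c₁ * D.ρ₁ ^ 2 : ℝ) : ℂ) * (D.pInv (-(I * D.α)) i + D.qInv (-(I * D.α)) i)
      + ((D.c₂ * D.ρ₂ ^ 2 : ℝ) : ℂ) * (D.pInv 0 i + D.qInv 0 i) = D.p i + D.q i := by
  have e1 : D.p i + D.q i = (D.G (D.p i) (D.q i) + 1) * (D.p i + D.q i) := by rw [hG]; ring
  rw [e1]
  simp only [G, pInv, qInv, sub_neg_eq_add, ← sub_eq_add_neg, sub_zero, add_zero]
  field_simp
  ring

/-- The denominators of the soliton formulas do not vanish. -/
structure Regular (D : DarkData N) : Prop where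
  add : ∀ i j, D.p i + D.q j ≠ 0
  p : ∀ i (c : ℝ), D.p i + I * c ≠ 0
  q : ∀ i (c : ℝ), D.q i + I * c ≠ 0

theorem ConjRel.regular {h : ℕ} (hc : D.ConjRel h)
    (hpq : ∀ i j, D.p i + D.q j ≠ 0) : D.Regular := by
  have key : ∀ i (c : ℝ), D.p i + I * c ≠ 0 := fun i c h0 => by
    apply hc.p_re_ne_zero hpq i
    simpa using congrArg Complex.re h0
  exact ⟨hpq, key, fun i c => by rw [hc.q_eq]; exact key _ c⟩

theorem potential_eq_sum (hR : D.Regular) (hG : ∀ i, D.G (D.p i) (D.q i) = 0) {x t : ℝ}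
    (hf : D.f x t ≠ 0) :
    D.potential x t =
      ((D.c₁ * D.ρ₁ ^ 2 : ℝ) : ℂ) * (1 - D.ratio (I * D.α) x t *
          (1 - invPairing (D.mat x t) (D.q ^ 0) (D.pInv (I * D.α))))
      + ((D.c₁ * D.ρ₁ ^ 2 : ℝ) : ℂ) * (1 - D.ratio (-(I * D.α)) x t *
          (1 - invPairing (D.mat x t) (D.q ^ 0) (D.pInv (-(I * D.α)))))
      + ((D.c₂ * D.ρ₂ ^ 2 : ℝ) : ℂ) * (1 - D.ratio 0 x t *
          (1 - invPairing (D.mat x t) (D.q ^ 0) (D.pInv 0))) := by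
  have p1 : ∀ i, D.p i - I * D.α ≠ 0 := fun i => by
    simpa [sub_eq_add_neg] using hR.p i (-D.α)
  have q1 : ∀ i, D.q i + I * D.α ≠ 0 := fun i => hR.q i D.α
  have p2 : ∀ i, D.p i - -(I * D.α) ≠ 0 := fun i => by simpa using hR.p i D.α
  have q2 : ∀ i, D.q i + -(I * D.α) ≠ 0 := fun i => by simpa using hR.q i (-D.α)
  have p3 : ∀ i, D.p i - 0 ≠ 0 := fun i => by simpa using hR.p i 0
  have q3 : ∀ i, D.q i + 0 ≠ 0 := fun i => by simpa using hR.q i 0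
  have d1 := (((hasDerivAt_invPairing_qInv_pInv hR.add p1 q1 hf).const_mul
      ((D.c₁ * D.ρ₁ ^ 2 : ℝ) : ℂ)).add
    ((hasDerivAt_invPairing_qInv_pInv hR.add p2 q2 hf).const_mul
      ((D.c₁ * D.ρ₁ ^ 2 : ℝ) : ℂ))).add
    ((hasDerivAt_invPairing_qInv_pInv hR.add p3 q3 hf).const_mul
      ((D.c₂ * D.ρ₂ ^ 2 : ℝ) : ℂ))
  have d2 := (hasDerivAt_momentPairing_zero hR.add hf).sub_const
    (∑ i, (D.p i + D.q i) - (((D.c₁ * D.ρ₁ ^ 2 : ℝ) : ℂ) *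
        ∑ i, (D.pInv (I * D.α) i + D.qInv (I * D.α) i)
      + ((D.c₁ * D.ρ₁ ^ 2 : ℝ) : ℂ) * ∑ i, (D.pInv (-(I * D.α)) i + D.qInv (-(I * D.α)) i)
      + ((D.c₂ * D.ρ₂ ^ 2 : ℝ) : ℂ) * ∑ i, (D.pInv 0 i + D.qInv 0 i)))
  -- Near `x`, the weighted sum of pole brackets equals `⟨1, 1⟩` minus a constant; both sides are
  -- then differentiated.
  refine d2.unique (d1.congr_of_eventuallyEq ?_)
  filter_upwards [eventually_f_ne_zero hf] with y hy
  have e0 : D.momentPairing 0 0 y t = ∑ i, (D.p i + D.q i)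
      - ∑ i, (D.mat y t)⁻¹ i i * ((D.p i + D.q i) * D.diagPart y t i) :=
    invPairing_eq_sum_sub hR.add (fun i j => by simp) (by rwa [f_eq_det] at hy)
  simp only [Pi.add_apply]
  rw [invPairing_qInv_pInv hR.add p1 q1 hy, invPairing_qInv_pInv hR.add p2 q2 hy,
    invPairing_qInv_pInv hR.add p3 q3 hy, e0]
  have e1 : ∑ i, (D.mat y t)⁻¹ i i * ((D.p i + D.q i) * D.diagPart y t i) =
      ((D.c₁ * D.ρ₁ ^ 2 : ℝ) : ℂ) * ∑ i, (D.mat y t)⁻¹ i i *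
        ((D.pInv (I * D.α) i + D.qInv (I * D.α) i) * D.diagPart y t i)
      + ((D.c₁ * D.ρ₁ ^ 2 : ℝ) : ℂ) * ∑ i, (D.mat y t)⁻¹ i i *
        ((D.pInv (-(I * D.α)) i + D.qInv (-(I * D.α)) i) * D.diagPart y t i)
      + ((D.c₂ * D.ρ₂ ^ 2 : ℝ) : ℂ) * ∑ i, (D.mat y t)⁻¹ i i *
        ((D.pInv 0 i + D.qInv 0 i) * D.diagPart y t i) := by
    simp only [Finset.mul_sum, ← Finset.sum_add_distrib]
    refine Finset.sum_congr rfl fun i _ => ?_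
    rw [← sum_weights_eq (hG i) (p1 i) (q1 i) (by simpa using p2 i)
      (by simpa [sub_eq_add_neg] using q2 i) (by simpa using p3 i) (by simpa using q3 i)]
    ring
  rw [e1]
  ring

theorem potential_eq {h : ℕ} (hc : D.ConjRel h) (hR : D.Regular)
    (hG : ∀ i, D.G (D.p i) (D.q i) = 0) {x t : ℝ} (hf : D.f x t ≠ 0) :
    D.potential x t = D.κ - 2 * D.c₁ * D.ρ₁ ^ 2 * ‖D.ratio (I * D.α) x t‖ ^ 2
      - D.c₂ * D.ρ₂ ^ 2 * D.ratio 0 x t ^ 2 := by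
  have e1 : D.ratio (-(I * D.α)) x t = conj (D.ratio (I * D.α) x t) := by
    rw [hc.conj_ratio]; simp
  rw [potential_eq_sum hR hG hf]
  simp only [hc.invPairing_pInv, neg_neg, neg_zero]
  have e2 : ∀ a, 1 - D.polePairing a 0 x t = D.ratio a x t := fun a => rfl
  rw [e2, e2, e2, e1, ← mul_conj', κ]
  push_cast
  ring

end DarkData

/-! ### From the linear problem to the nonlinear system. -/

theorem iteratedDeriv_three_eq {F : Type*} [NormedAddCommGroup F] [NormedSpace ℝ F]
    {g g₁ g₂ : ℝ → F} {g₃ : F} {x : ℝ} (h₁ : ∀ᶠ y in 𝓝 x, HasDerivAt g (g₁ y) y)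
    (h₂ : ∀ᶠ y in 𝓝 x, HasDerivAt g₁ (g₂ y) y) (h₃ : HasDerivAt g₂ g₃ x) :
    iteratedDeriv 3 g x = g₃ := by
  have e₁ : deriv g =ᶠ[𝓝 x] g₁ := h₁.mono fun y hy => hy.deriv
  have e₂ : deriv (deriv g) =ᶠ[𝓝 x] g₂ := e₁.deriv.trans (h₂.mono fun y hy => hy.deriv)
  rw [iteratedDeriv_succ, iteratedDeriv_succ, iteratedDeriv_one, e₂.deriv_eq, h₃.deriv]

theorem HasDerivAt.complex_re {g : ℝ → ℂ} {g' : ℂ} {x : ℝ} (h : HasDerivAt g g' x) :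
    HasDerivAt (fun y => (g y).re) g'.re x :=
  (reCLM.hasFDerivAt (x := g x)).comp_hasDerivAt x h

namespace DarkData

variable {N : ℕ} {D : DarkData N}

theorem planeWave_eq (x t : ℝ) : D.planeWave (I * D.α) x t = exp (I * (D.θ x t : ℂ)) := by
  unfold planeWave θ
  congr 1
  push_cast
  rw [mul_pow, I_pow_three]
  ring

theorem planeWave_zero (x t : ℝ) : D.planeWave 0 x t = 1 := by
  simp [planeWave]

theorem u_eq (hR : D.Regular) {x t : ℝ} (hf : D.f x t ≠ 0) :
    D.u x t = D.ρ₁ * (D.ratio (I * D.α) x t * D.planeWave (I * D.α) x t) := by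
  rw [u, τ_one_zero hR.add x t (fun j => hR.q j _) hf, mul_div_cancel_left₀ _ hf, planeWave_eq,
    mul_assoc]

theorem w_eq (hR : D.Regular) {x t : ℝ} (hf : D.f x t ≠ 0) :
    D.w x t = D.ρ₂ * (D.ratio 0 x t * D.planeWave 0 x t) := by
  rw [w, τ_zero_one hR.add x t (fun j => by simpa using hR.q j 0) hf,
    mul_div_cancel_left₀ _ hf, planeWave_zero, mul_one]

theorem norm_u_sq (hR : D.Regular) {x t : ℝ} (hf : D.f x t ≠ 0) :
    ‖D.u x t‖ ^ 2 = D.ρ₁ ^ 2 * ‖D.ratio (I * D.α) x t‖ ^ 2 := by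
  rw [u_eq hR hf, planeWave_eq, norm_mul, norm_mul, mul_comm I (D.θ x t : ℂ), norm_exp_ofReal_mul_I, norm_real,
    mul_one, mul_pow, Real.norm_eq_abs, sq_abs]

theorem ofReal_re_w {h : ℕ} (hc : D.ConjRel h) (hR : D.Regular) {x t : ℝ} (hf : D.f x t ≠ 0) :
    ((D.w x t).re : ℂ) = D.w x t := by
  rw [← conj_eq_iff_re, w_eq hR hf, planeWave_zero, mul_one, map_mul, conj_ofReal,
    hc.conj_ratio, map_zero]

theorem potential_eq_ofReal {h : ℕ} (hc : D.ConjRel h) (hR : D.Regular)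
    (hG : ∀ i, D.G (D.p i) (D.q i) = 0) {x t : ℝ} (hf : D.f x t ≠ 0) :
    D.potential x t =
      ((D.κ - 2 * D.c₁ * ‖D.u x t‖ ^ 2 - D.c₂ * (D.w x t).re ^ 2 : ℝ) : ℂ) := by
  rw [potential_eq hc hR hG hf, norm_u_sq hR hf]
  push_cast
  rw [ofReal_re_w hc hR hf, w_eq hR hf, planeWave_zero]
  ring

/-- A multiple of the wave function solves the linear problem with the given potential. -/
theorem exists_hasDerivAt_linearProblem {h : ℕ} (hc : D.ConjRel h) (hR : D.Regular) {a c : ℂ}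
    (ha : ∀ j, D.q j + a ≠ 0) {g : ℝ → ℝ → ℂ}
    (hg : ∀ {x t}, D.f x t ≠ 0 → g x t = c * (D.ratio a x t * D.planeWave a x t))
    {x t : ℝ} (hf : D.f x t ≠ 0) :
    ∃ (g₁ g₂ : ℝ → ℂ) (g₃ : ℂ),
      (∀ᶠ y in 𝓝 x, HasDerivAt (fun z => g z t) (g₁ y) y) ∧
      (∀ᶠ y in 𝓝 x, HasDerivAt g₁ (g₂ y) y) ∧ HasDerivAt g₂ g₃ x ∧
      HasDerivAt (fun s => g x s) (g₃ + 3 * D.potential x t * g₁ x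
        + 3 / 2 * D.potentialDeriv x t * g x t - 3 * D.κ * g₁ x) t := by
  have hev := eventually_f_ne_zero hf
  refine ⟨fun y => c * (D.waveDeriv₁ a y t * D.planeWave a y t),
    fun y => c * (D.waveDeriv₂ a y t * D.planeWave a y t), _, ?_, ?_,
    (hasDerivAt_waveDeriv₂ hR.add ha hf).const_mul c, ?_⟩
  · filter_upwards [hev.eventually_nhds, hev] with y hy hy'
    refine ((hasDerivAt_wave hR.add ha hy').const_mul c).congr_of_eventuallyEq ?_
    filter_upwards [hy] with z hz using hg hz
  · filter_upwards [hev] with y hy using (hasDerivAt_waveDeriv₁ hR.add ha hy).const_mul c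
  · have h1 := ((hasDerivAt_wave_t hR.add ha hf (hc.momentPairing_comm x t)).const_mul
      c).congr_of_eventuallyEq
      ((eventually_f_ne_zero_t hf).mono fun s hs => hg hs)
    convert! h1 using 1
    rw [hg hf]
    ring

theorem contDiffAt_quotient (k l : ℤ) {x t : ℝ} (hf : D.f x t ≠ 0) :
    ContDiffAt ℝ ∞ (fun z : ℝ × ℝ => D.τ k l z.1 z.2 / D.τ 0 0 z.1 z.2) (x, t) := by
  simp only [div_eq_mul_inv]
  exact (contDiff_τ k l).contDiffAt.mul ((contDiff_τ 0 0).contDiffAt.inv hf)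

theorem contDiffAt_u {x t : ℝ} (hf : D.f x t ≠ 0) :
    ContDiffAt ℝ ∞ (fun z : ℝ × ℝ => D.u z.1 z.2) (x, t) := by
  have h1 : ContDiff ℝ ∞ (fun z : ℝ × ℝ => (D.θ z.1 z.2 : ℂ)) := by
    unfold θ
    exact (ofRealCLM.contDiff (n := ∞)).comp (f := fun z : ℝ × ℝ =>
      D.α * z.1 - (D.α ^ 3 + 3 * D.α * D.κ) * z.2) (by fun_prop)
  exact (contDiffAt_const.mul (contDiffAt_quotient 1 0 hf)).mul
    (contDiff_const.mul h1).cexp.contDiffAt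

theorem contDiffAt_re_w {x t : ℝ} (hf : D.f x t ≠ 0) :
    ContDiffAt ℝ ∞ (fun z : ℝ × ℝ => (D.w z.1 z.2).re) (x, t) :=
  reCLM.contDiff.contDiffAt.comp (x, t)
    (contDiffAt_const.mul (contDiffAt_quotient 0 1 hf))

theorem solvesSSmKdVAt {h : ℕ} (hc : D.ConjRel h) (hR : D.Regular)
    (hG : ∀ i, D.G (D.p i) (D.q i) = 0) {x t : ℝ} (hf : D.f x t ≠ 0) :
    SolvesSSmKdVAt D.c₁ D.c₂ D.u (fun x t => (D.w x t).re) x t := by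
  obtain ⟨u₁, u₂, u₃, hu₁, hu₂, hu₃, hut⟩ := exists_hasDerivAt_linearProblem hc hR
    (fun j => hR.q j D.α) (u_eq hR) hf
  obtain ⟨w₁, w₂, w₃, hw₁, hw₂, hw₃, hwt⟩ := exists_hasDerivAt_linearProblem hc hR
    (a := 0) (fun j => by simpa using hR.q j 0) (w_eq hR) hf
  have hv₁ := hw₁.mono fun y hy => hy.complex_re
  have hv₂ := hw₂.mono fun y hy => hy.complex_re
  have hv := hv₁.self_of_nhds
  have hu := hu₁.self_of_nhds
  have hn := hu.norm_sq
  set n' := 2 * inner ℝ (D.u x t) (u₁ x) with hn'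
  have hU := potential_eq_ofReal hc hR hG hf
  -- The formula for the potential holds on a neighbourhood, so it may be differentiated in `x`.
  have hU' : D.potentialDeriv x t =
      ((-(2 * D.c₁ * n') - D.c₂ * (2 * (D.w x t).re * (w₁ x).re) : ℝ) : ℂ) := by
    have h1 := (((hn.const_mul (2 * D.c₁)).const_sub D.κ).sub
      ((hv.pow 2).const_mul D.c₂)).ofReal_comp
    refine (hasDerivAt_potential hR.add hf).unique ?_
    convert! h1.congr_of_eventuallyEq (f₁ := fun y => D.potential y t) ?_ using 1
    · simp
    · filter_upwards [eventually_f_ne_zero hf] with y hy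
      rw [potential_eq_ofReal hc hR hG hy]
      rfl
  refine ⟨contDiffAt_u hf, contDiffAt_re_w hf, ?_, ?_⟩
  · have huv : deriv (fun y => D.u y t * ((D.w y t).re : ℂ)) x =
        u₁ x * (D.w x t).re + D.u x t * (w₁ x).re := (hu.mul hv.ofReal_comp).deriv
    rw [hut.deriv, iteratedDeriv_three_eq hu₁ hu₂ hu₃, hn.deriv, hu.deriv, huv, hU, hU']
    push_cast
    ring
  · rw [hwt.complex_re.deriv, iteratedDeriv_three_eq hv₁ hv₂ hw₃.complex_re, hn.deriv, hv.deriv,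
      hU, hU', ← ofReal_re_w hc hR hf, show (3 / 2 : ℂ) = ((3 / 2 : ℝ) : ℂ) by norm_num,
      show (3 : ℂ) = ((3 : ℝ) : ℂ) by norm_num]
    simp only [← ofReal_mul, sub_re, add_re, re_ofReal_mul, ofReal_re]
    ring

end DarkData

/-! ### Asymptotics of diagonal-plus-Cauchy determinants. -/

section CauchyAsymptotics

open Matrix

variable {ι : Type*} [Fintype ι] [DecidableEq ι]

open Polynomial in
/-- A Cauchy matrix with distinct nodes is nonsingular. -/
theorem det_cauchy_ne_zero {p q : ι → ℂ} (hp : Function.Injective p) (hq : Function.Injective q)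
    (hpq : ∀ i j, p i + q j ≠ 0) : (Matrix.of fun i j => 1 / (p i + q j)).det ≠ 0 := by
  intro h0
  obtain ⟨v, hv, hv0⟩ := Matrix.exists_mulVec_eq_zero_iff.2 h0
  apply hv
  -- The numerator of `∑ v j / (z + q j)`: its degree is below the number of its roots `p i`, and
  -- its value at `-q j` isolates `v j`.
  let P : ℂ[X] := ∑ j, C (v j) * ∏ k ∈ Finset.univ.erase j, (X + C (q k))
  have hev : ∀ z, P.eval z = ∑ j, v j * ∏ k ∈ Finset.univ.erase j, (z + q k) := fun z => by
    simp [P, eval_finsetSum, eval_prod]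
  have hroot : ∀ i, P.eval (p i) = 0 := by
    intro i
    have h1 := congrFun hv0 i
    simp only [mulVec, dotProduct, of_apply, Pi.zero_apply] at h1
    rw [hev]
    calc _ = (∏ k, (p i + q k)) * ∑ j, 1 / (p i + q j) * v j := by
          rw [Finset.mul_sum]
          refine Finset.sum_congr rfl fun j _ => ?_
          rw [← Finset.mul_prod_erase _ _ (Finset.mem_univ j)]
          have := hpq i j
          field_simp
      _ = 0 := by rw [h1, mul_zero]
  have hP : P = 0 := by
    refine eq_zero_of_degree_lt_of_eval_index_eq_zero (s := Finset.univ) (v := p) hp.injOn ?_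
      (fun i _ => hroot i)
    rw [degree_lt_iff_coeff_zero]
    intro m hm
    simp only [P, finsetSum_coeff, coeff_C_mul]
    refine Finset.sum_eq_zero fun j _ => ?_
    rw [coeff_eq_zero_of_natDegree_lt, mul_zero]
    refine lt_of_le_of_lt (natDegree_prod_le _ _) ?_
    simp only [natDegree_X_add_C, Finset.sum_const, smul_eq_mul, mul_one,
      Finset.card_erase_of_mem (Finset.mem_univ j)]
    have : 0 < (Finset.univ : Finset ι).card := Finset.card_pos.2 ⟨j, Finset.mem_univ j⟩
    omega
  ext j
  have h2 := hev (-q j)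
  rw [hP, eval_zero, Finset.sum_eq_single j] at h2
  · refine (mul_eq_zero.1 h2.symm).resolve_right (Finset.prod_ne_zero_iff.2 fun k hk => ?_)
    rw [neg_add_eq_sub, sub_ne_zero]
    exact fun h => (Finset.mem_erase.1 hk).1 (hq h)
  · intro k _ hk
    rw [Finset.prod_eq_zero (Finset.mem_erase.2 ⟨hk.symm, Finset.mem_univ j⟩) (by ring), mul_zero]
  · simp

/-- If the diagonal entries `e i` go to infinity for `i` in `S` and to zero otherwise, then
`det (diag e + K)` behaves like `∏ i ∈ S, e i` times the complementary minor of `K`. -/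
theorem tendsto_scaled_det_diagonal_add {l : Filter ℝ} {e : ℝ → ι → ℂ} (S : ι → Prop)
    [DecidablePred S]
    (h0 : ∀ i, ¬ S i → Tendsto (fun y => e y i) l (𝓝 0))
    (h1 : ∀ i, S i → Tendsto (fun y => (e y i)⁻¹) l (𝓝 0))
    (hne : ∀ i, S i → ∀ y, e y i ≠ 0) (K : Matrix ι ι ℂ) :
    Tendsto (fun y => (∏ i, if S i then (e y i)⁻¹ else 1) * (diagonal (e y) + K).det) l
      (𝓝 (K.toSquareBlockProp fun i => ¬ S i).det) := by
  -- The limit after dividing the rows in `S` by their diagonal entries: those rows become identity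
  -- rows.
  let L : Matrix ι ι ℂ := Matrix.of fun i j => if S i then (if i = j then 1 else 0) else K i j
  have hL : L.det = (K.toSquareBlockProp fun i => ¬ S i).det := by
    rw [Matrix.twoBlockTriangular_det' L S (fun i hi j hj => by
      have : i ≠ j := fun h => hj (h ▸ hi)
      simp [L, hi, this])]
    have e1 : L.toSquareBlockProp S = 1 := by
      ext i j
      simp [L, toSquareBlockProp, i.2, one_apply, Subtype.ext_iff]
    have e2 : (L.toSquareBlockProp fun i => ¬ S i) = K.toSquareBlockProp fun i => ¬ S i := by
      ext i j
      simp [L, toSquareBlockProp, i.2]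
    rw [e1, e2, det_one, one_mul]
  rw [← hL]
  have hlim : Tendsto (fun y => diagonal (fun i => if S i then (e y i)⁻¹ else 1) *
      (diagonal (e y) + K)) l (𝓝 L) := by
    refine tendsto_pi_nhds.2 fun i => tendsto_pi_nhds.2 fun j => ?_
    simp only [diagonal_mul, Matrix.add_apply, diagonal_apply]
    by_cases hi : S i
    · simp only [L, of_apply, hi, if_true]
      have h2 : ∀ y, (e y i)⁻¹ * ((if i = j then e y i else 0) + K i j) =
          (if i = j then 1 else 0) + (e y i)⁻¹ * K i j := fun y => by
        have := hne i hi y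
        split_ifs <;> field_simp
        ring
      simp only [h2]
      simpa using ((h1 i hi).mul_const (K i j)).const_add (if i = j then (1 : ℂ) else 0)
    · simp only [L, of_apply, hi, if_false, one_mul]
      by_cases hij : i = j
      · subst hij
        simpa using (h0 i hi).add_const (K i i)
      · simpa [hij] using tendsto_const_nhds
  have hdet : Continuous (fun A : Matrix ι ι ℂ => A.det) := continuous_id.matrix_det
  refine ((hdet.tendsto L).comp hlim).congr fun y => ?_
  simp [det_mul, det_diagonal]

/-- The two limiting minors differ by row factors `r i` and column factors `s j`; `π` preserves the
complement of `S` and matches them with modulus one. -/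
theorem tendsto_norm_det_ratio {l : Filter ℝ} {e : ℝ → ι → ℂ} (S : ι → Prop)
    [DecidablePred S]
    (h0 : ∀ i, ¬ S i → Tendsto (fun y => e y i) l (𝓝 0))
    (h1 : ∀ i, S i → Tendsto (fun y => (e y i)⁻¹) l (𝓝 0))
    (hne : ∀ i, S i → ∀ y, e y i ≠ 0) {p q r s : ι → ℂ}
    (hp : Function.Injective p) (hq : Function.Injective q) (hpq : ∀ i j, p i + q j ≠ 0)
    (π : Equiv.Perm ι) (hπ : ∀ i, S (π i) ↔ S i) (hrs : ∀ i, ‖r i‖ * ‖s (π i)‖ = 1) :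
    (∀ᶠ y in l, (cauchyDiag p q (e y)).det ≠ 0) ∧
    Tendsto (fun y => ‖(diagonal (e y) + Matrix.of fun i j => 1 / (p i + q j) * (r i * s j)).det
      / (cauchyDiag p q (e y)).det‖) l (𝓝 1) := by
  have t0 := tendsto_scaled_det_diagonal_add S h0 h1 hne (Matrix.of fun i j => 1 / (p i + q j))
  have t1 := tendsto_scaled_det_diagonal_add S h0 h1 hne
    (Matrix.of fun i j => 1 / (p i + q j) * (r i * s j))
  set Δ := ((Matrix.of fun i j => 1 / (p i + q j)).toSquareBlockProp fun i => ¬ S i).det with hΔ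
  have hΔ0 : Δ ≠ 0 := det_cauchy_ne_zero (p := fun i : {i // ¬ S i} => p i) (q := fun i => q i)
    (hp.comp Subtype.val_injective) (hq.comp Subtype.val_injective) (fun i j => hpq i j)
  have hΔ1 : ((Matrix.of fun i j => 1 / (p i + q j) * (r i * s j)).toSquareBlockProp
      fun i => ¬ S i).det = (∏ i : {i // ¬ S i}, r i) * Δ * ∏ i : {i // ¬ S i}, s i := by
    rw [hΔ, ← det_diagonal, ← det_diagonal, ← det_mul, ← det_mul]
    congr 1
    ext i j
    simp only [toSquareBlockProp, of_apply, mul_diagonal, diagonal_mul, toBlock_apply]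
    ring
  have hnorm : ‖(∏ i : {i // ¬ S i}, r i) * Δ * (∏ i : {i // ¬ S i}, s i) / Δ‖ = 1 := by
    rw [mul_right_comm, mul_div_cancel_right₀ _ hΔ0, norm_mul, norm_prod, norm_prod,
      ← Equiv.prod_comp (π.subtypePerm (p := fun i => ¬ S i) fun i => not_congr (hπ i))
        (fun i => ‖s i‖), ← Finset.prod_mul_distrib]
    exact Finset.prod_eq_one fun i _ => hrs i
  refine ⟨(t0.eventually_ne hΔ0).mono fun y hy => right_ne_zero_of_mul hy, ?_⟩
  rw [hΔ1] at t1
  rw [← hnorm]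
  refine (t1.div t0 hΔ0).norm.congr fun y => ?_
  rw [Pi.div_apply, cauchyDiag, mul_div_mul_left]
  refine Finset.prod_ne_zero_iff.2 fun i _ => ?_
  split_ifs with hi
  · exact inv_ne_zero (hne i hi y)
  · exact one_ne_zero

end CauchyAsymptotics

/-! ### Boundary behaviour of the solitons. -/

namespace DarkData

variable {N : ℕ} {D : DarkData N}

theorem h₁_eq_det (x t : ℝ) : D.h₁ x t = (Matrix.diagonal (D.diagPart x t) + Matrix.of fun i j =>
    1 / (D.p i + D.q j) * (-(D.p i - I * D.α) * (D.q j + I * D.α)⁻¹)).det := by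
  unfold h₁ τ
  congr 1
  ext i j
  simp only [Matrix.of_apply, Matrix.add_apply, Matrix.diagonal_apply, diagPart, zpow_one,
    zpow_zero, mul_one, neg_mul, div_eq_mul_inv]
  by_cases hij : i = j
  · subst hij; simp
  · simp [hij]

theorem h₂_eq_det (x t : ℝ) : D.h₂ x t = (Matrix.diagonal (D.diagPart x t) + Matrix.of fun i j =>
    1 / (D.p i + D.q j) * (-D.p i * (D.q j)⁻¹)).det := by
  unfold h₂ τ
  congr 1
  ext i j
  simp only [Matrix.of_apply, Matrix.add_apply, Matrix.diagonal_apply, diagPart, zpow_one,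
    zpow_zero, mul_one, neg_mul, div_eq_mul_inv]
  by_cases hij : i = j
  · subst hij; simp
  · simp [hij]

theorem norm_exp_phase (i : Fin N) (x t : ℝ) :
    ‖exp (-D.ξ i x t - D.η i x t)‖ =
      Real.exp (-(D.p i + D.q i).re * x + (-D.ξ i 0 t - D.η i 0 t).re) := by
  rw [norm_exp, ξ, η, ξ, η]
  congr 1
  simp
  ring

theorem tendsto_diagPart {l : Filter ℝ} {i : Fin N} {t : ℝ}
    (h : Tendsto (fun x => -(D.p i + D.q i).re * x) l atBot) :
    Tendsto (fun x => D.diagPart x t i) l (𝓝 0) := by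
  rw [tendsto_zero_iff_norm_tendsto_zero]
  simp only [diagPart, norm_mul, norm_exp_phase]
  simpa using (Real.tendsto_exp_atBot.comp (tendsto_atBot_add_const_right l _ h)).const_mul
    ‖(D.d i : ℂ)‖

theorem tendsto_inv_diagPart {l : Filter ℝ} {i : Fin N} {t : ℝ}
    (h : Tendsto (fun x => -(D.p i + D.q i).re * x) l atTop) :
    Tendsto (fun x => (D.diagPart x t i)⁻¹) l (𝓝 0) := by
  rw [tendsto_zero_iff_norm_tendsto_zero]
  simp only [diagPart, norm_inv, norm_mul, norm_exp_phase, mul_inv]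
  simpa using (tendsto_inv_atTop_zero.comp (Real.tendsto_exp_atTop.comp
    (tendsto_atTop_add_const_right l _ h))).const_mul ‖(D.d i : ℂ)‖⁻¹

theorem tendsto_norm_quotients {h : ℕ} (hc : D.ConjRel h) (hR : D.Regular)
    (hinj : Function.Injective D.p) {l : Filter ℝ} {ε : ℝ} (hε : ε * ε = 1)
    (hl : Tendsto (fun y => ε * y) l atTop) (t : ℝ) :
    (∀ᶠ x in l, D.f x t ≠ 0) ∧ Tendsto (fun x => ‖D.h₁ x t / D.f x t‖) l (𝓝 1) ∧
      Tendsto (fun x => ‖D.h₂ x t / D.f x t‖) l (𝓝 1) := by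
  classical
  obtain ⟨σ, hσ⟩ := hc.exists_perm
  -- The entries that blow up as `ε x → ∞`; those with `d i = 0` vanish identically and are
  -- excluded.
  let S : Fin N → Prop := fun i => D.d i ≠ 0 ∧ ε * (D.p i + D.q i).re < 0
  -- Chosen so that `q (π i) = conj (p i)`, whence `|q (π i) + i c| = |p i - i c|` for real `c`.
  let π : Equiv.Perm (Fin N) := σ.trans Fin.revPerm
  have hπ : ∀ i, π i = (σ i).rev := fun i => rfl
  have hre : ∀ i, (D.p i + D.q i).re ≠ 0 := fun i h0 =>
    hR.add i i (Complex.ext h0 (hc.add_im i))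
  have hqπ : ∀ i, D.q (π i) = conj (D.p i) := fun i => by
    rw [hπ, ← hc.p_eq, (hσ i).1]
  have hpπ : ∀ i, D.p (π i) = conj (D.q i) := fun i => by
    rw [hπ, ← hc.q_eq, (hσ i).2.1]
  have hS : ∀ i, S (π i) ↔ S i := fun i => by
    have e1 : D.d (π i) = D.d i := by rw [hπ, ← (hc.1 _).1, (hσ i).2.2.1]
    have e2 : (D.p (π i) + D.q (π i)).re = (D.p i + D.q i).re := by
      rw [hqπ, hpπ]; simp [add_comm]
    simp only [S, e1, e2]
  have hlin : ∀ (c y : ℝ), -c * y = -(ε * c) * (ε * y) := fun c y => by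
    linear_combination (c * y) * hε
  have h1 : ∀ i, S i → Tendsto (fun y => (D.diagPart y t i)⁻¹) l (𝓝 0) := fun i hi => by
    refine tendsto_inv_diagPart ?_
    simp only [hlin (D.p i + D.q i).re]
    exact hl.const_mul_atTop (by linarith [hi.2])
  have h0 : ∀ i, ¬ S i → Tendsto (fun y => D.diagPart y t i) l (𝓝 0) := fun i hi => by
    by_cases hd : D.d i = 0
    · simpa [diagPart, hd] using tendsto_const_nhds
    refine tendsto_diagPart ?_
    simp only [hlin (D.p i + D.q i).re]
    have h2 : 0 ≤ ε * (D.p i + D.q i).re := not_lt.1 fun h => hi ⟨hd, h⟩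
    have h3 : ε * (D.p i + D.q i).re ≠ 0 :=
      mul_ne_zero (fun h => by simp [h] at hε) (hre i)
    exact hl.const_mul_atTop_of_neg (by linarith [h2.lt_of_ne h3.symm])
  have hne : ∀ i, S i → ∀ y, D.diagPart y t i ≠ 0 := fun i hi y =>
    mul_ne_zero (ofReal_ne_zero.2 hi.1) (exp_ne_zero _)
  have hqinj : Function.Injective D.q := fun i j hij => by
    rw [hc.q_eq, hc.q_eq] at hij
    exact Fin.rev_injective (hinj hij)
  -- `c = α` serves `h₁` and `c = 0` serves `h₂`.
  have key := fun (c : ℝ) => tendsto_norm_det_ratio S h0 h1 hne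
    (r := fun i => -(D.p i - I * c)) (s := fun j => (D.q j + I * c)⁻¹) hinj hqinj hR.add π hS
    (fun i => by
      have e1 : D.q (π i) + I * c = conj (D.p i - I * c) := by
        rw [hqπ]; simp
      have e2 : D.q (π i) + I * c ≠ 0 := hR.q _ c
      rw [e1] at e2
      simp only [e1, norm_inv, RCLike.norm_conj, norm_neg] at e2 ⊢
      exact mul_inv_cancel₀ (norm_ne_zero_iff.2 fun h => e2 (by rw [h, map_zero])))
  simp only [f_eq_det, mat, h₁_eq_det, h₂_eq_det]
  exact ⟨(key 0).1, (key D.α).2, by simpa using (key 0).2⟩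

theorem norm_u_eq (x t : ℝ) : ‖D.u x t‖ = |D.ρ₁| * ‖D.h₁ x t / D.f x t‖ := by
  rw [u, norm_mul, norm_mul, mul_comm I (D.θ x t : ℂ), norm_exp_ofReal_mul_I, norm_real, mul_one,
    Real.norm_eq_abs]

theorem norm_w_eq (x t : ℝ) : ‖D.w x t‖ = |D.ρ₂| * ‖D.h₂ x t / D.f x t‖ := by
  rw [w, norm_mul, norm_real, Real.norm_eq_abs]

end DarkData

theorem theorem3p2 (N : ℕ) (D : DarkData N) (h : ℕ) (hh : h ≤ N / 2)
    (hconj : D.ConjRel h)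
    (hG : ∀ i, D.G (D.p i) (D.q i) = 0)
    (hpq : ∀ i j, D.p i + D.q j ≠ 0) :
    ∃ v : ℝ → ℝ → ℝ,
      (∀ x t, D.f x t ≠ 0 → (v x t : ℂ) = D.w x t) ∧
      (∀ x t, D.f x t ≠ 0 → SolvesSSmKdVAt D.c₁ D.c₂ D.u v x t) ∧
      (Function.Injective D.p → ∀ t,
        (∀ᶠ x in atBot ⊔ atTop, D.f x t ≠ 0) ∧
        Tendsto (fun x => ‖D.u x t‖) (atBot ⊔ atTop) (𝓝 |D.ρ₁|) ∧
        Tendsto (fun x => |v x t|) (atBot ⊔ atTop) (𝓝 |D.ρ₂|)) := by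
  have hR := hconj.regular hpq
  refine ⟨fun x t => (D.w x t).re, fun x t hf => DarkData.ofReal_re_w hconj hR hf,
    fun x t hf => DarkData.solvesSSmKdVAt hconj hR hG hf, fun hinj t => ?_⟩
  have key : ∀ {l : Filter ℝ} {ε : ℝ}, ε * ε = 1 → Tendsto (fun y => ε * y) l atTop →
      (∀ᶠ x in l, D.f x t ≠ 0) ∧ Tendsto (fun x => ‖D.u x t‖) l (𝓝 |D.ρ₁|) ∧
        Tendsto (fun x => |(D.w x t).re|) l (𝓝 |D.ρ₂|) := by
    intro l ε hε hl
    obtain ⟨k0, k1, k2⟩ := DarkData.tendsto_norm_quotients hconj hR hinj hε hl t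
    refine ⟨k0, ?_, ?_⟩
    · simpa [DarkData.norm_u_eq] using k1.const_mul |D.ρ₁|
    · have k3 : Tendsto (fun x => ‖D.w x t‖) l (𝓝 |D.ρ₂|) := by
        simpa [DarkData.norm_w_eq] using k2.const_mul |D.ρ₂|
      refine k3.congr' ?_
      filter_upwards [k0] with x hx
      rw [← DarkData.ofReal_re_w hconj hR hx, norm_real, Real.norm_eq_abs, ofReal_re]
  -- The sign `ε` selects the end of the line.
  have kb := key (l := atBot) (ε := -1) (by norm_num) (by simpa using tendsto_neg_atBot_atTop)
  have kt := key (l := atTop) (ε := 1) (by norm_num) (by simpa using! tendsto_id)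
  exact ⟨eventually_sup.2 ⟨kb.1, kt.1⟩, kb.2.1.sup kt.2.1, kb.2.2.sup kt.2.2⟩
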